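/- Let $\sigma_1=\begin{pmatrix}0&1\\1&0\end{pmatrix}$, $\sigma_2=\begin{pmatrix}1&0\\0&-1\end{pmatrix}$, let $m\ge 1$ and $N\ge 0$ be integers, and index the standard basis of $\mathbb{C}^{2^m}=(\mathbb{C}^2)^{\otimes m}$ by $\mathbb{F}_2^m$. Let $E(m)\cong 2_+^{1+2m}$ be the group generated by all tensor products of $m$ matrices of size $2\times 2$ of which one is $\sigma_1$ or $\sigma_2$ and the others are $I_2$, and let $E(m)\,\mathsf{Y}\,Z_4=\langle E(m), iI\rangle$. Let $\zeta_8=e^{2\pi i/8}$, and let $U(2^m,\mathbb{Q}(\zeta_8))$ be the group of unitary matrices with entries in $\mathbb{Q}(\zeta_8)\subset\mathbb{C}$. The complex Clifford group $\mathcal{X}_m$, of structure $(2_+^{1+2m}\,\mathsf{Y}\,Z_8).Sp(2m,2)$, is the group generated by the elements of finite order of the normalizer of $E(m)\,\mathsf{Y}\,Z_4$ in $U(2^m,\mathbb{Q}(\zeta_8))$. It acts on polynomials in the $2^m$ variables $x_v$, $v\in\mathbb{F}_2^m$, by the linear substitutions $g\cdot x_w=\sum_v g_{vw}x_v$. A binary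 code $C\le\mathbb{F}_2^N$ (a linear subspace) is self-dual if $C=C^\perp$ with respect to the standard inner product, and doubly-even if the weight of every codeword is divisible by $4$. For such a code let $C(m)=C\otimes_{\mathbb{F}_2}\mathbb{F}_{2^m}\le\mathbb{F}_{2^m}^N$, and let $$\mathrm{cwe}(C(m))=\sum_{c\in C(m)}\ \prod_{f\in\mathbb{F}_{2^m}}x_f^{a_f(c)}$$ be its complete weight enumerator, where $a_f(c)$ is the number of components of $c$ equal to $f$, and where $\mathbb{F}_{2^m}$ is identified with $\mathbb{F}_2^m$ by means of an arbitrary fixed $\mathbb{F}_2$-basis. **Theorem (Runge, complex case).** The complex vector space of polynomials that are homogeneous of degree $N$ and invariant under $\mathcal{X}_m$ is spanned by the polynomials $\mathrm{cwe}(C(m))$, where $C$ runs over all binary doubly-even self-dual codes of length $N$. In particular, if $N$ is not a multiple of $8$, this space is $\{0\}$. -/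

import Mathlib

namespace Clifford

noncomputable section

/-! ### The complex Clifford group -/

/-- The unitary `2 × 2` matrix `σ₁ = (0 1; 1 0)`, rows and columns indexed by `𝔽₂`. -/
def sigma1 : Matrix.unitaryGroup (ZMod 2) ℂ :=
  ⟨Matrix.of fun a b => if a = b then 0 else 1, by
    rw [Matrix.mem_unitaryGroup_iff]
    have hu : (Finset.univ : Finset (ZMod 2)) = {0, 1} := rfl
    have h2 : ∀ a : ZMod 2, a = 0 ∨ a = 1 := by decide
    ext a b
    rcases h2 a with rfl | rfl <;> rcases h2 b with rfl | rfl <;>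
      simp [Matrix.mul_apply, Matrix.star_apply, hu]⟩

/-- The unitary `2 × 2` matrix `σ₂ = (1 0; 0 -1)`, rows and columns indexed by `𝔽₂`. -/
def sigma2 : Matrix.unitaryGroup (ZMod 2) ℂ :=
  ⟨Matrix.diagonal fun a => if a = 0 then 1 else -1, by
    rw [Matrix.mem_unitaryGroup_iff]
    rw [Matrix.star_eq_conjTranspose, Matrix.diagonal_conjTranspose,
      Matrix.diagonal_mul_diagonal, ← Matrix.diagonal_one]
    congr 1
    funext a
    by_cases ha : a = 0 <;> simp [ha]⟩

/-- The tensor (Kronecker) product `A₁ ⊗ ⋯ ⊗ A_m` of unitary `2 × 2` matrices, acting on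
`ℂ² ⊗ ⋯ ⊗ ℂ²`, whose standard basis is indexed by `𝔽₂^m`. -/
def tensor {m : ℕ} (A : Fin m → Matrix.unitaryGroup (ZMod 2) ℂ) :
    Matrix.unitaryGroup (Fin m → ZMod 2) ℂ :=
  ⟨Matrix.of fun v w => ∏ j, (A j : Matrix (ZMod 2) (ZMod 2) ℂ) (v j) (w j), by
    rw [Matrix.mem_unitaryGroup_iff]
    ext v w
    have h : ∀ j, ∑ x, (A j : Matrix (ZMod 2) (ZMod 2) ℂ) (v j) x *
        star ((A j : Matrix (ZMod 2) (ZMod 2) ℂ) (w j) x) =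
          (1 : Matrix (ZMod 2) (ZMod 2) ℂ) (v j) (w j) := by
      intro j
      rw [← Matrix.mem_unitaryGroup_iff.mp (A j).2, Matrix.mul_apply]
      rfl
    simp only [Matrix.mul_apply, Matrix.star_apply, Matrix.of_apply, star_prod,
      ← Finset.prod_mul_distrib]
    rw [← Fintype.piFinset_univ, ← Finset.prod_univ_sum (fun _ => Finset.univ)
      (fun j x => (A j : Matrix (ZMod 2) (ZMod 2) ℂ) (v j) x *
        star ((A j : Matrix (ZMod 2) (ZMod 2) ℂ) (w j) x))]
    rw [Finset.prod_congr rfl fun j _ => h j]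
    simp only [Matrix.one_apply]
    by_cases hvw : v = w
    · simp [hvw]
    · obtain ⟨j, hj⟩ := Function.ne_iff.mp hvw
      rw [if_neg hvw]
      exact Finset.prod_eq_zero (Finset.mem_univ j) (if_neg hj)⟩

/-- The extraspecial group `E(m)`, generated by the tensor products of one factor `σ₁` or `σ₂`
with `2 × 2` identity matrices. -/
def extraspecialGroup (m : ℕ) : Subgroup (Matrix.unitaryGroup (Fin m → ZMod 2) ℂ) :=
  Subgroup.closure
    {g | ∃ j : Fin m, g = tensor (Pi.mulSingle j sigma1) ∨ g = tensor (Pi.mulSingle j sigma2)}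

/-- The scalar matrix `i · I`. -/
def scalarI (n : Type*) [Fintype n] [DecidableEq n] : Matrix.unitaryGroup n ℂ :=
  ⟨Complex.I • 1, by
    rw [Matrix.mem_unitaryGroup_iff]
    simp [smul_smul]⟩

/-- The central product `E(m) Y Z₄`, where `Z₄` is the group of scalar matrices generated by
`i · I`. -/
def centralProduct (m : ℕ) : Subgroup (Matrix.unitaryGroup (Fin m → ZMod 2) ℂ) :=
  extraspecialGroup m ⊔ Subgroup.zpowers (scalarI (Fin m → ZMod 2))

/-- The primitive eighth root of unity `ζ₈ = exp (2πi / 8)`. -/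
def zeta8 : ℂ := Complex.exp (2 * Real.pi * Complex.I / 8)

/-- The cyclotomic field `ℚ(ζ₈)`, as a subfield of `ℂ`. -/
def cyclo8 : IntermediateField ℚ ℂ := IntermediateField.adjoin ℚ {zeta8}

theorem star_mem_cyclo8 {z : ℂ} (hz : z ∈ cyclo8) : star z ∈ cyclo8 := by
  have key : cyclo8 ≤ cyclo8.comap (Complex.conjAe.toAlgHom.restrictScalars ℚ) := by
    refine IntermediateField.adjoin_le_iff.mpr ?_
    rintro _ rfl
    change star zeta8 ∈ cyclo8
    have h : star zeta8 = zeta8⁻¹ := by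
      rw [zeta8, ← Complex.exp_neg]
      change (starRingEnd ℂ) _ = _
      rw [← Complex.exp_conj]
      congr 1
      have h2 : (starRingEnd ℂ) 2 = 2 := map_ofNat _ 2
      have h8 : (starRingEnd ℂ) 8 = 8 := map_ofNat _ 8
      simp [neg_div, h2, h8]
    rw [h]
    exact inv_mem (IntermediateField.subset_adjoin ℚ _ rfl)
  exact key hz

/-- The unitary group `U(n, ℚ(ζ₈))`: the unitary matrices with all entries in `ℚ(ζ₈)`. -/
def unitaryGroupCyclo8 (n : Type*) [Fintype n] [DecidableEq n] :
    Subgroup (Matrix.unitaryGroup n ℂ) where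
  carrier := {g | ∀ i j, (g : Matrix n n ℂ) i j ∈ cyclo8}
  mul_mem' {g h} hg hh i j := by
    change ((g : Matrix n n ℂ) * (h : Matrix n n ℂ)) i j ∈ cyclo8
    rw [Matrix.mul_apply]
    exact sum_mem fun k _ => mul_mem (hg i k) (hh k j)
  one_mem' i j := by
    change (1 : Matrix n n ℂ) i j ∈ cyclo8
    rw [Matrix.one_apply]
    split_ifs
    · exact one_mem _
    · exact zero_mem _
  inv_mem' {g} hg i j := by
    change star ((g : Matrix n n ℂ) j i) ∈ cyclo8
    exact star_mem_cyclo8 (hg j i)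

/-- The normalizer of `E(m) Y Z₄` in `U(2^m, ℚ(ζ₈))`. -/
def cliffordNormalizer (m : ℕ) : Subgroup (Matrix.unitaryGroup (Fin m → ZMod 2) ℂ) :=
  Subgroup.normalizer (centralProduct m) ⊓ unitaryGroupCyclo8 (Fin m → ZMod 2)

/-- The complex Clifford group `X_m = (2_+^{1+2m} Y Z₈).Sp(2m, 2)`: the group generated by the
elements of finite order of the normalizer of `E(m) Y Z₄` in `U(2^m, ℚ(ζ₈))`.

The full normalizer is the product of this finite group and the infinite group of all scalar
matrices `z · I` with `z ∈ ℚ(ζ₈)` and `|z| = 1` (for instance `z = (3 + 4i) / 5`); restricting to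
elements of finite order leaves exactly the scalars `Z₈ = ⟨ζ₈ · I⟩`. -/
def complexCliffordGroup (m : ℕ) : Subgroup (Matrix.unitaryGroup (Fin m → ZMod 2) ℂ) :=
  Subgroup.closure {g | g ∈ cliffordNormalizer m ∧ IsOfFinOrder g}

/-! ### Polynomial invariants -/

/-- The action of a matrix `g` on polynomials by the linear substitution of the variables
`x_w ↦ ∑ v, g_{v w} x_v`. -/
def polyAct {n : Type*} [Fintype n] (g : Matrix n n ℂ) :
    MvPolynomial n ℂ →ₐ[ℂ] MvPolynomial n ℂ :=
  MvPolynomial.aeval fun w => ∑ v, MvPolynomial.C (g v w) * MvPolynomial.X v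

/-- The space of invariants of a matrix group that are homogeneous of degree `N`. -/
def homogeneousInvariants {n : Type*} [Fintype n] [DecidableEq n]
    (G : Subgroup (Matrix.unitaryGroup n ℂ)) (N : ℕ) : Submodule ℂ (MvPolynomial n ℂ) where
  carrier := {p | p.IsHomogeneous N ∧ ∀ g ∈ G, polyAct (g : Matrix n n ℂ) p = p}
  add_mem' hp hq := ⟨hp.1.add hq.1, fun g hg => by rw [map_add, hp.2 g hg, hq.2 g hg]⟩
  zero_mem' := ⟨MvPolynomial.isHomogeneous_zero _ _ _, fun _ _ => map_zero _⟩
  smul_mem' a p hp :=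
    ⟨(MvPolynomial.homogeneousSubmodule n ℂ N).smul_mem a hp.1,
      fun g hg => by rw [map_smul, hp.2 g hg]⟩

/-! ### Codes and complete weight enumerators -/

/-- A binary linear code `C ≤ 𝔽₂^N` is self-dual if `C = C^⊥` for the standard inner product. -/
def IsSelfDual {N : ℕ} (C : Submodule (ZMod 2) (Fin N → ZMod 2)) : Prop :=
  ∀ v : Fin N → ZMod 2, v ∈ C ↔ ∀ c ∈ C, v ⬝ᵥ c = 0

/-- A binary linear code is doubly-even if the weights of all its codewords are divisible
by `4`. -/
def IsDoublyEven {N : ℕ} (C : Submodule (ZMod 2) (Fin N → ZMod 2)) : Prop :=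
  ∀ c ∈ C, 4 ∣ hammingNorm c

/-- The extension `C ⊗ F` of a binary code `C ≤ 𝔽₂^N` to a code over an extension field `F`:
the `F`-span of `C` in `F^N`. -/
def extendScalars (F : Type*) [Field F] [Algebra (ZMod 2) F] {N : ℕ}
    (C : Submodule (ZMod 2) (Fin N → ZMod 2)) : Submodule F (Fin N → F) :=
  Submodule.span F ((fun (c : Fin N → ZMod 2) (i : Fin N) => algebraMap (ZMod 2) F (c i)) '' C)

open Classical in
/-- The complete weight enumerator `∑_{c ∈ D} ∏_{f ∈ F} x_f ^ a_f(c)` of a code `D ≤ F^N`, where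
`a_f(c)` is the number of components of `c` that are equal to `f`. -/
def cwe {F : Type*} [Field F] [Fintype F] {N : ℕ} (D : Submodule F (Fin N → F)) :
    MvPolynomial F ℂ :=
  ∑ c : Fin N → F with c ∈ D, ∏ f : F, MvPolynomial.X f ^ Finset.card {i : Fin N | c i = f}

end

end Clifford

namespace Clifford

noncomputable section

set_option linter.unusedSectionVars false

/-! ### Tensors and polynomials -/

section Tensor

variable {n ι : Type*} [Fintype n] [DecidableEq n] [Fintype ι] [DecidableEq ι]

/-! A polynomial of degree `N` is the symmetrization `toPoly f` of a tensor `f`, a function of `m ×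
N` arrays `A` over `𝔽₂` with columns `A i`. In coordinates a word of `C ⊗ F` is an array with all
rows in `C`, so its complete weight enumerator is the symmetrization of the indicator `psi m C` of
such arrays (`rename_cwe_extendScalars`).

Enumerators are invariant. Let `C` be self-dual and doubly-even. For `c ∈ C` and `Q ∈ E(m) Y Z₄`,
applying `Q` at the positions in the support of `c` fixes `psi m C`, and these operators have no
common fixed tensors beyond its multiples (`eq_smul_psi`). Conjugation by an element `g` of the
normalizer preserves this family, so `g^{⊗N}` multiplies `psi m C` by a scalar `l`. Evaluated at a
constant array, `l` is a natural number times `φ(0)^N`, where `φ` is a row of `g` with `φ(0) ≠ 0`.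
The support of `φ` is a subspace of size `2^r` on which `|φ|` is constant
(`exists_rowStabilizer_hasShift`, `prod_apply_eq_pow`). Hence `l = z^N` with `z = φ(0) √2^r` of
absolute value 1. If `g` has finite order and `N > 0`, then `z` is a root of unity in `ℚ(ζ₈)`, so
`z^8 = 1`; since `8 ∣ N` by a Gauss sum, `l = 1` (`tact_psi_eq_self`).

Invariants are enumerators. The diagonal Clifford gates force `8 ∣ N` for a nonzero invariant and
allow only monomials whose rows span a doubly-even code. Affine permutations of `𝔽₂^m` make the
coefficients depend only on the code generated by the rows and the all-one word. Möbius inversion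
then puts the invariant in the span of the `psi m D` with `D` doubly-even and containing `1`
(`mem_span_psi_of_invariant`). Finally, an average of gates `(1 + iX_u)/√2`, cut down to admissible
monomials, fixes every invariant and is triangular for inclusion of codes: it sends `psi m D` to a
multiple of itself plus terms for the codes obtained by adjoining one word
(`gateAverage_toPoly_psi`). The diagonal coefficient is less than 1 unless `D` is self-dual, so only
self-dual codes are needed (`mem_span_of_triangular`). -/

/-- The action of a family of matrices on tensors, one matrix for every tensor factor. -/
def tact (M : ι → Matrix n n ℂ) : ((ι → n) → ℂ) →ₗ[ℂ] ((ι → n) → ℂ) where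
  toFun f B := ∑ A, (∏ i, M i (B i) (A i)) * f A
  map_add' f g := by
    funext B
    simp [mul_add, Finset.sum_add_distrib]
  map_smul' a f := by
    funext B
    simp [Finset.mul_sum, mul_left_comm]

theorem tact_apply (M : ι → Matrix n n ℂ) (f : (ι → n) → ℂ) (B : ι → n) :
    tact M f B = ∑ A, (∏ i, M i (B i) (A i)) * f A := rfl

theorem sum_prod_eq_prod_sum (h : ι → n → ℂ) :
    ∑ A : ι → n, ∏ i, h i (A i) = ∏ i, ∑ x, h i x := by
  rw [← Fintype.piFinset_univ, ← Finset.prod_univ_sum (fun _ => Finset.univ) h]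

theorem tact_mul (M M' : ι → Matrix n n ℂ) (f : (ι → n) → ℂ) :
    tact (fun i => M i * M' i) f = tact M (tact M' f) := by
  funext B
  simp only [tact_apply, Matrix.mul_apply, Finset.mul_sum]
  rw [Finset.sum_comm]
  refine Finset.sum_congr rfl fun A _ => ?_
  rw [← sum_prod_eq_prod_sum, Finset.sum_mul]
  refine Finset.sum_congr rfl fun A' _ => ?_
  rw [Finset.prod_mul_distrib, mul_assoc]

theorem prod_one_apply (A B : ι → n) :
    ∏ i, (1 : Matrix n n ℂ) (B i) (A i) = if B = A then 1 else 0 := by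
  simp only [Matrix.one_apply]
  by_cases h : B = A
  · simp [h]
  · obtain ⟨j, hj⟩ := Function.ne_iff.mp h
    rw [if_neg h]
    exact Finset.prod_eq_zero (Finset.mem_univ j) (if_neg hj)

theorem tact_one (f : (ι → n) → ℂ) : tact (fun _ => (1 : Matrix n n ℂ)) f = f := by
  funext B
  simp [tact_apply, prod_one_apply]

/-- The monomial attached to a basis tensor. -/
def mono (A : ι → n) : n →₀ ℕ := ∑ i, Finsupp.single (A i) 1

/-- Symmetrization of tensors to homogeneous polynomials. -/
def toPoly : ((ι → n) → ℂ) →ₗ[ℂ] MvPolynomial n ℂ where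
  toFun f := ∑ A, MvPolynomial.monomial (mono A) (f A)
  map_add' f g := by simp [Finset.sum_add_distrib]
  map_smul' a f := by simp [Finset.smul_sum, MvPolynomial.smul_monomial]

theorem toPoly_apply (f : (ι → n) → ℂ) :
    toPoly f = ∑ A, MvPolynomial.monomial (mono A) (f A) := rfl

theorem monomial_mono (A : ι → n) (a : ℂ) :
    MvPolynomial.monomial (mono A) a =
      MvPolynomial.C a * ∏ i, (MvPolynomial.X (A i) : MvPolynomial n ℂ) := by
  simp only [MvPolynomial.X]
  rw [← MvPolynomial.monomial_sum_one, MvPolynomial.C_mul_monomial, mul_one]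
  rfl

/-- Expanding a product of substituted variables applies `g` in each tensor factor; invariance of a
tensor therefore implies invariance of its polynomial. -/
theorem polyAct_toPoly (g : Matrix n n ℂ) (f : (ι → n) → ℂ) :
    polyAct g (toPoly f) = toPoly (tact (fun _ => g) f) := by
  simp only [toPoly_apply, map_sum, monomial_mono, map_mul, map_prod, tact_apply]
  simp only [polyAct, MvPolynomial.aeval_X, MvPolynomial.algHom_C, MvPolynomial.algebraMap_eq]
  have : ∀ A : ι → n, ∏ i, ∑ v, MvPolynomial.C (g v (A i)) * MvPolynomial.X v =
      ∑ B : ι → n, ∏ i, MvPolynomial.C (g (B i) (A i)) *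
        (MvPolynomial.X (B i) : MvPolynomial n ℂ) := by
    intro A
    rw [← Fintype.piFinset_univ, ← Finset.prod_univ_sum (fun _ => Finset.univ)
      (fun i v => MvPolynomial.C (g v (A i)) * (MvPolynomial.X v : MvPolynomial n ℂ))]
  simp only [this, Finset.mul_sum]
  rw [Finset.sum_comm]
  refine Finset.sum_congr rfl fun B _ => ?_
  refine Finset.sum_congr rfl fun A _ => ?_
  rw [Finset.prod_mul_distrib]
  ring

theorem degree_mono (A : ι → n) : (mono A).degree = Fintype.card ι := by
  simp [mono]

theorem toPoly_isHomogeneous (f : (ι → n) → ℂ) :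
    (toPoly f).IsHomogeneous (Fintype.card ι) := by
  rw [toPoly_apply]
  refine MvPolynomial.IsHomogeneous.sum _ _ _ fun A _ => ?_
  exact MvPolynomial.isHomogeneous_monomial _ (degree_mono A)

theorem exists_mono {N : ℕ} (s : n →₀ ℕ) (hs : s.degree = N) : ∃ A : Fin N → n, mono A = s := by
  subst hs
  induction s using Finsupp.induction_linear with
  | zero => exact ⟨fun i => (Fin.elim0 (i.cast (by simp))), by
      rw [mono]
      exact Finset.sum_eq_zero fun i _ => (Fin.elim0 (i.cast (by simp)))⟩
  | add s t hs ht =>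
    obtain ⟨A, hA⟩ := hs
    obtain ⟨B, hB⟩ := ht
    refine ⟨fun i => Fin.append A B (i.cast (by simp)), ?_⟩
    have h := Fin.sum_univ_add (fun i => Finsupp.single (Fin.append A B i) 1)
    simp only [Fin.append_left, Fin.append_right] at h
    refine Eq.trans ?_ (h.trans (congrArg₂ (· + ·) hA hB))
    exact Fintype.sum_equiv (finCongr (by simp)) _ _ fun i => rfl
  | single a k =>
    refine ⟨fun _ => a, ?_⟩
    simp [mono]

/-- The symmetric tensor that lifts a homogeneous polynomial. -/
def symLift (p : MvPolynomial n ℂ) (A : ι → n) : ℂ :=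
  ((Finset.univ.filter fun B : ι → n => mono B = mono A).card : ℂ)⁻¹ * p.coeff (mono A)

/-- Each coefficient is shared equally among all orderings of its monomial, and summing over the
orderings restores it. -/
theorem toPoly_symLift {N : ℕ} {p : MvPolynomial n ℂ} (hp : p.IsHomogeneous N) :
    toPoly (symLift p : (Fin N → n) → ℂ) = p := by
  ext s
  simp only [toPoly_apply, MvPolynomial.coeff_sum, MvPolynomial.coeff_monomial, symLift]
  rw [← Finset.sum_filter]
  by_cases hs : s.degree = N
  · obtain ⟨A, rfl⟩ := exists_mono s hs
    rw [Finset.sum_congr rfl (g := fun _ =>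
      ((Finset.univ.filter fun B : Fin N → n => mono B = mono A).card : ℂ)⁻¹ * p.coeff (mono A))]
    · rw [Finset.sum_const, nsmul_eq_mul, ← mul_assoc, mul_inv_cancel₀, one_mul]
      rw [Nat.cast_ne_zero, ← Nat.pos_iff_ne_zero, Finset.card_pos]
      exact ⟨A, by simp⟩
    · intro B hB
      rw [(Finset.mem_filter.mp hB).2]
  · rw [hp.coeff_eq_zero hs, Finset.sum_eq_zero]
    intro A hA
    refine absurd ?_ hs
    rw [← (Finset.mem_filter.mp hA).2, degree_mono, Fintype.card_fin]

end Tensor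

/-! ### Signs, eighth roots of unity -/

/-- The nontrivial character of `𝔽₂`. -/
def sgn (x : ZMod 2) : ℂ := if x = 0 then 1 else -1

theorem zmod_two_cases (x : ZMod 2) : x = 0 ∨ x = 1 := by
  revert x; decide

@[simp] theorem sgn_zero : sgn 0 = 1 := if_pos rfl

@[simp] theorem sgn_one : sgn 1 = -1 := if_neg one_ne_zero

theorem sgn_add (x y : ZMod 2) : sgn (x + y) = sgn x * sgn y := by
  rcases zmod_two_cases x with rfl | rfl <;> rcases zmod_two_cases y with rfl | rfl <;>
    simp [show (1 + 1 : ZMod 2) = 0 from rfl]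

theorem sgn_mul_self (x : ZMod 2) : sgn x * sgn x = 1 := by
  rw [← sgn_add, CharTwo.add_self_eq_zero, sgn_zero]

theorem star_sgn (x : ZMod 2) : star (sgn x) = sgn x := by
  rcases zmod_two_cases x with rfl | rfl <;> simp

theorem zeta8_isPrimitiveRoot : IsPrimitiveRoot zeta8 8 := by
  have := Complex.isPrimitiveRoot_exp 8 (by norm_num)
  simpa [zeta8] using this

theorem sqrt_two_mul_zeta8 : (Real.sqrt 2 : ℂ) * zeta8 = 1 + Complex.I := by
  have h : (2 * Real.pi * Complex.I / 8 : ℂ) = ((Real.pi / 4 : ℝ) : ℂ) * Complex.I := by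
    push_cast; ring
  have h2 : (Real.sqrt 2 : ℂ) * Real.sqrt 2 = 2 := by
    exact_mod_cast Real.mul_self_sqrt (by norm_num : (0 : ℝ) ≤ 2)
  rw [zeta8, h, Complex.exp_mul_I, ← Complex.ofReal_cos, ← Complex.ofReal_sin,
    Real.cos_pi_div_four, Real.sin_pi_div_four]
  push_cast
  linear_combination (1 / 2 + Complex.I / 2) * h2

theorem sqrt_two_sq : (Real.sqrt 2 : ℂ) ^ 2 = 2 := by
  exact_mod_cast Real.sq_sqrt (by norm_num : (0 : ℝ) ≤ 2)

theorem sqrt_two_ne_zero : (Real.sqrt 2 : ℂ) ≠ 0 := by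
  intro h
  have := sqrt_two_sq
  rw [h] at this
  norm_num at this

theorem zeta8_sq : zeta8 ^ 2 = Complex.I := by
  have h : (Real.sqrt 2 * zeta8 : ℂ) ^ 2 = (1 + Complex.I) ^ 2 := by rw [sqrt_two_mul_zeta8]
  rw [mul_pow, sqrt_two_sq] at h
  linear_combination h / 2 + (1 / 2) * Complex.I_sq

theorem zeta8_mem : zeta8 ∈ cyclo8 := IntermediateField.subset_adjoin ℚ _ rfl

theorem I_mem_cyclo8 : Complex.I ∈ cyclo8 := zeta8_sq ▸ pow_mem zeta8_mem 2

theorem sqrt_two_mem_cyclo8 : (Real.sqrt 2 : ℂ) ∈ cyclo8 := by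
  have h : (Real.sqrt 2 : ℂ) = (1 + Complex.I) / zeta8 := by
    rw [← sqrt_two_mul_zeta8, mul_div_cancel_right₀]
    exact zeta8_isPrimitiveRoot.ne_zero (by norm_num)
  rw [h]
  exact div_mem (add_mem (one_mem _) I_mem_cyclo8) zeta8_mem

/-- The eighth cyclotomic field has exactly 8 roots of unity, because 8 is even. This is what the
restriction to entries in `ℚ(ζ₈)` contributes to the invariance of enumerators. -/
theorem pow_eight_eq_one_of_mem_cyclo8 {z : ℂ} (hz : z ∈ cyclo8) {k : ℕ} (hk : 0 < k)
    (h : z ^ k = 1) : z ^ 8 = 1 := by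
  have : IsCyclotomicExtension {8} ℚ cyclo8 := by
    change IsCyclotomicExtension {8} ℚ cyclo8.toSubalgebra
    rw [cyclo8, IntermediateField.adjoin_simple_toSubalgebra_of_isAlgebraic
      (zeta8_isPrimitiveRoot.isIntegral (by norm_num)).tower_top.isAlgebraic]
    exact zeta8_isPrimitiveRoot.adjoin_isCyclotomicExtension ℚ
  have : NumberField cyclo8 := IsCyclotomicExtension.numberField {8} ℚ cyclo8
  have ht := IsCyclotomicExtension.Rat.torsionOrder_eq (n := 8) (K := cyclo8)
  rw [if_pos (by decide)] at ht
  set y : cyclo8 := ⟨z, hz⟩ with hy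
  have hyk : y ^ k = 1 := Subtype.ext h
  have ho : 0 < orderOf y := orderOf_pos_iff.mpr (isOfFinOrder_iff_pow_eq_one.mpr ⟨k, hk, hyk⟩)
  have : NeZero (orderOf y) := ⟨ho.ne'⟩
  have hd := NumberField.Units.dvd_torsionOrder_of_isPrimitiveRoot (IsPrimitiveRoot.orderOf y)
  rw [ht] at hd
  exact congrArg Subtype.val (orderOf_dvd_iff_pow_eq_one.mp hd)

/-! ### Pauli matrices and Clifford gates -/

/-- Permutation matrices. -/
def permU {n : Type*} [Fintype n] [DecidableEq n] (π : Equiv.Perm n) : Matrix.unitaryGroup n ℂ :=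
  ⟨Matrix.of fun v w => if v = π w then 1 else 0, by
    rw [Matrix.mem_unitaryGroup_iff]
    ext v w
    have h : ∀ v x, v = π x ↔ x = π.symm v := fun v x => by rw [Equiv.eq_symm_apply, eq_comm]
    simp only [Matrix.mul_apply, Matrix.star_apply, h, Matrix.one_apply, Matrix.of_apply]
    simp [eq_comm]⟩

theorem permU_apply {n : Type*} [Fintype n] [DecidableEq n] (π : Equiv.Perm n) (v w : n) :
    (permU π : Matrix n n ℂ) v w = if v = π w then 1 else 0 := rfl

theorem permU_mul {n : Type*} [Fintype n] [DecidableEq n] (π ρ : Equiv.Perm n) :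
    permU (π * ρ) = permU π * permU ρ := by
  ext v w
  simp [Matrix.mul_apply, permU_apply]
  rfl

theorem permU_one {n : Type*} [Fintype n] [DecidableEq n] :
    permU (1 : Equiv.Perm n) = 1 := by
  ext v w
  simp [Matrix.one_apply, permU_apply]
  rfl

theorem isOfFinOrder_permU {n : Type*} [Fintype n] [DecidableEq n] (π : Equiv.Perm n) :
    IsOfFinOrder (permU π) :=
  MonoidHom.isOfFinOrder (⟨⟨permU, permU_one⟩, permU_mul⟩ : Equiv.Perm n →* _)
    (isOfFinOrder_of_finite π)

variable {m : ℕ}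

/-- The matrix `e_v ↦ e_{v + a}`. -/
def shiftU (a : Fin m → ZMod 2) : Matrix.unitaryGroup (Fin m → ZMod 2) ℂ :=
  permU (Equiv.addRight a)

theorem shiftU_apply (a v w : Fin m → ZMod 2) :
    (shiftU a : Matrix (Fin m → ZMod 2) (Fin m → ZMod 2) ℂ) v w = if v = w + a then 1 else 0 := rfl

/-- The diagonal matrix `e_v ↦ (-1)^χ(v) e_v`. -/
def signU (χ : Module.Dual (ZMod 2) (Fin m → ZMod 2)) : Matrix.unitaryGroup (Fin m → ZMod 2) ℂ :=
  ⟨Matrix.diagonal fun v => sgn (χ v), by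
    rw [Matrix.mem_unitaryGroup_iff, Matrix.star_eq_conjTranspose, Matrix.diagonal_conjTranspose,
      Matrix.diagonal_mul_diagonal, ← Matrix.diagonal_one]
    congr 1
    funext v
    rw [Pi.star_apply, star_sgn, sgn_mul_self]⟩

theorem signU_coe (χ : Module.Dual (ZMod 2) (Fin m → ZMod 2)) :
    (signU χ : Matrix (Fin m → ZMod 2) (Fin m → ZMod 2) ℂ) =
      Matrix.diagonal fun v => sgn (χ v) := rfl

theorem shiftU_add (a b : Fin m → ZMod 2) : shiftU (a + b) = shiftU a * shiftU b := by
  rw [shiftU, shiftU, shiftU, ← permU_mul]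
  congr 1
  ext v : 1
  simp only [Equiv.Perm.mul_apply, Equiv.coe_addRight]
  abel

theorem shiftU_zero : shiftU (0 : Fin m → ZMod 2) = 1 := by
  ext v w
  simp [shiftU_apply, Matrix.one_apply]

theorem signU_add (χ χ' : Module.Dual (ZMod 2) (Fin m → ZMod 2)) :
    signU (χ + χ') = signU χ * signU χ' := by
  apply Subtype.ext
  rw [Submonoid.coe_mul, signU_coe, signU_coe, signU_coe, Matrix.diagonal_mul_diagonal]
  simp [sgn_add]

theorem signU_zero : signU (0 : Module.Dual (ZMod 2) (Fin m → ZMod 2)) = 1 := by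
  apply Subtype.ext
  simp [signU_coe]

theorem tensor_apply (A : Fin m → Matrix.unitaryGroup (ZMod 2) ℂ) (v w : Fin m → ZMod 2) :
    (tensor A : Matrix (Fin m → ZMod 2) (Fin m → ZMod 2) ℂ) v w =
      ∏ k, (A k : Matrix (ZMod 2) (ZMod 2) ℂ) (v k) (w k) := rfl

theorem tensor_sigma1 (j : Fin m) :
    tensor (Pi.mulSingle j sigma1) = shiftU (Pi.single j 1) := by
  ext v w
  have h : ∀ k, ((Pi.mulSingle j sigma1 : Fin m → _) k : Matrix (ZMod 2) (ZMod 2) ℂ) (v k) (w k) =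
      if v k = (w + Pi.single j 1 : Fin m → ZMod 2) k then 1 else 0 := by
    intro k
    by_cases hk : k = j
    · subst hk
      rw [Pi.mulSingle_eq_same]
      change (if v k = w k then (0 : ℂ) else 1) = _
      rw [Pi.add_apply, Pi.single_eq_same]
      rcases zmod_two_cases (v k) with h | h <;> rcases zmod_two_cases (w k) with h' | h' <;>
        simp [h, h', show (1 + 1 : ZMod 2) = 0 from rfl]
    · rw [Pi.mulSingle_eq_of_ne hk, Pi.add_apply, Pi.single_eq_of_ne hk, add_zero]
      exact Matrix.one_apply
  rw [tensor_apply, Finset.prod_congr rfl fun k _ => h k, shiftU_apply, Finset.prod_ite_zero]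
  simp [funext_iff]

theorem tensor_sigma2 (j : Fin m) :
    tensor (Pi.mulSingle j sigma2) = signU (LinearMap.proj j) := by
  ext v w
  have h : ∀ k, ((Pi.mulSingle j sigma2 : Fin m → _) k : Matrix (ZMod 2) (ZMod 2) ℂ) (v k) (w k) =
      (if v k = w k then 1 else 0) * if k = j then sgn (v j) else 1 := by
    intro k
    by_cases hk : k = j
    · subst hk
      rw [Pi.mulSingle_eq_same]
      change Matrix.diagonal _ _ _ = _
      rw [Matrix.diagonal_apply, if_pos rfl, ite_mul, one_mul, zero_mul]
      rfl
    · rw [Pi.mulSingle_eq_of_ne hk, if_neg hk, mul_one]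
      exact Matrix.one_apply
  rw [tensor_apply, Finset.prod_congr rfl fun k _ => h k, signU_coe, Finset.prod_mul_distrib,
    Finset.prod_ite_zero, Matrix.diagonal_apply]
  simp [funext_iff]

theorem scalarI_mem : scalarI (Fin m → ZMod 2) ∈ centralProduct m :=
  (le_sup_right : _ ≤ centralProduct m) (Subgroup.mem_zpowers _)

theorem shiftU_mem (a : Fin m → ZMod 2) : shiftU a ∈ centralProduct m := by
  have h : ∀ s : Finset (Fin m), shiftU (∑ j ∈ s, Pi.single j (a j)) ∈ centralProduct m := by
    intro s
    induction s using Finset.induction_on with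
    | empty => simp [shiftU_zero]
    | insert j s hj ih =>
      rw [Finset.sum_insert hj, shiftU_add]
      refine mul_mem ?_ ih
      rcases zmod_two_cases (a j) with h | h
      · simp [h, shiftU_zero]
      · rw [h, ← tensor_sigma1]
        exact (le_sup_left : _ ≤ centralProduct m) (Subgroup.subset_closure ⟨j, Or.inl rfl⟩)
  have := h Finset.univ
  rwa [Finset.univ_sum_single] at this

theorem dual_eq_sum (χ : Module.Dual (ZMod 2) (Fin m → ZMod 2)) :
    χ = ∑ j, χ (Pi.single j 1) • LinearMap.proj j := by
  refine LinearMap.pi_ext' fun j => LinearMap.ext_ring ?_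
  simp [Pi.single_apply]

theorem signU_mem (χ : Module.Dual (ZMod 2) (Fin m → ZMod 2)) : signU χ ∈ centralProduct m := by
  have h : ∀ s : Finset (Fin m),
      signU (∑ j ∈ s, χ (Pi.single j 1) • LinearMap.proj j) ∈ centralProduct m := by
    intro s
    induction s using Finset.induction_on with
    | empty => simp [signU_zero]
    | insert j s hj ih =>
      rw [Finset.sum_insert hj, signU_add]
      refine mul_mem ?_ ih
      rcases zmod_two_cases (χ (Pi.single j 1)) with h | h
      · simp [h, signU_zero]
      · rw [h, one_smul, ← tensor_sigma2]
        exact (le_sup_left : _ ≤ centralProduct m) (Subgroup.subset_closure ⟨j, Or.inr rfl⟩)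
  have := h Finset.univ
  rwa [← dual_eq_sum] at this

theorem centralProduct_le {K : Subgroup (Matrix.unitaryGroup (Fin m → ZMod 2) ℂ)}
    (h1 : ∀ a, shiftU a ∈ K) (h2 : ∀ χ, signU χ ∈ K) (h3 : scalarI _ ∈ K) :
    centralProduct m ≤ K := by
  refine sup_le ((Subgroup.closure_le K).mpr ?_) (by simpa using h3)
  rintro g ⟨j, rfl | rfl⟩
  · rw [tensor_sigma1]; exact h1 _
  · rw [tensor_sigma2]; exact h2 _

theorem scalarI_mul_comm {n : Type*} [Fintype n] [DecidableEq n]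
    (g : Matrix.unitaryGroup n ℂ) : scalarI n * g = g * scalarI n := by
  apply Subtype.ext
  simp [scalarI]

/-- Conjugation by `g` needs to be checked only on generators and in one direction: since `g` has
finite order, `g⁻¹` is a power of `g` and gives the reverse inclusion. -/
theorem mem_complexCliffordGroup {g : Matrix.unitaryGroup (Fin m → ZMod 2) ℂ}
    (hg : IsOfFinOrder g) (h1 : ∀ a, g * shiftU a * g⁻¹ ∈ centralProduct m)
    (h2 : ∀ χ, g * signU χ * g⁻¹ ∈ centralProduct m)
    (h3 : ∀ v w, (g : Matrix (Fin m → ZMod 2) (Fin m → ZMod 2) ℂ) v w ∈ cyclo8) :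
    g ∈ complexCliffordGroup m := by
  refine Subgroup.subset_closure ⟨⟨?_, h3⟩, hg⟩
  have hle : centralProduct m ≤ (centralProduct m).comap (MulAut.conj g).toMonoidHom := by
    refine centralProduct_le h1 h2 ?_
    change g * scalarI _ * g⁻¹ ∈ centralProduct m
    rw [← scalarI_mul_comm, mul_inv_cancel_right]
    exact scalarI_mem
  have hpow : ∀ k : ℕ, ∀ h ∈ centralProduct m, g ^ k * h * (g ^ k)⁻¹ ∈ centralProduct m := by
    intro k
    induction k with
    | zero => simp
    | succ k ih =>
      intro h hh
      have := ih _ (hle hh)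
      simpa [pow_succ, mul_assoc] using this
  refine Subgroup.mem_normalizer_iff.mpr fun h => ?_
  refine ⟨fun hh => hle hh, fun hh => ?_⟩
  obtain ⟨k, hk, hgk⟩ := isOfFinOrder_iff_pow_eq_one.mp hg
  have := hpow (k - 1) _ hh
  have hinv : g ^ (k - 1) = g⁻¹ := by
    rw [eq_inv_iff_mul_eq_one, ← pow_succ, Nat.sub_add_cancel hk, hgk]
  rw [hinv] at this
  simpa [mul_assoc] using this

/-! ### Clifford gates attached to Pauli involutions and to affine permutations -/

/-- The gate `(1 + iP) / √2` attached to an involution `P`. -/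
def gateU {n : Type*} [Fintype n] [DecidableEq n] (P : Matrix.unitaryGroup n ℂ) (hP : P * P = 1) :
    Matrix.unitaryGroup n ℂ :=
  ⟨(Real.sqrt 2 : ℂ)⁻¹ • (1 + Complex.I • (P : Matrix n n ℂ)), by
    have h1 : (P : Matrix n n ℂ) * P = 1 := congrArg Subtype.val hP
    have h2 : star (P : Matrix n n ℂ) = P := congrArg Subtype.val (inv_eq_of_mul_eq_one_right hP)
    have hs : (Real.sqrt 2 : ℂ)⁻¹ * (Real.sqrt 2 : ℂ)⁻¹ = 1 / 2 := by
      rw [← mul_inv, ← sq, sqrt_two_sq, one_div]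
    rw [Matrix.mem_unitaryGroup_iff, star_smul, star_add, star_smul, star_one, h2]
    have : star (Real.sqrt 2 : ℂ)⁻¹ = (Real.sqrt 2 : ℂ)⁻¹ := by
      rw [← Complex.ofReal_inv]; exact Complex.conj_ofReal _
    have hI : star Complex.I = -Complex.I := Complex.conj_I
    rw [this, hI, smul_mul_smul_comm, hs]
    have : (1 + Complex.I • (P : Matrix n n ℂ)) * (1 + -Complex.I • (P : Matrix n n ℂ)) =
        (2 : ℂ) • 1 := by
      rw [add_mul, mul_add, mul_add, one_mul, one_mul, mul_one, smul_mul_smul_comm, h1]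
      simp [two_smul]
    rw [this, smul_smul]
    norm_num⟩

theorem gateU_coe {n : Type*} [Fintype n] [DecidableEq n] (P : Matrix.unitaryGroup n ℂ)
    (hP : P * P = 1) : (gateU P hP : Matrix n n ℂ) =
      (Real.sqrt 2 : ℂ)⁻¹ • (1 + Complex.I • (P : Matrix n n ℂ)) := rfl

theorem gateU_sq {n : Type*} [Fintype n] [DecidableEq n] (P : Matrix.unitaryGroup n ℂ)
    (hP : P * P = 1) : gateU P hP ^ 2 = scalarI n * P := by
  apply Subtype.ext
  have h1 : (P : Matrix n n ℂ) * P = 1 := congrArg Subtype.val hP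
  have hs : (Real.sqrt 2 : ℂ)⁻¹ * (Real.sqrt 2 : ℂ)⁻¹ = 1 / 2 := by
    rw [← mul_inv, ← sq, sqrt_two_sq, one_div]
  rw [sq, Submonoid.coe_mul, Submonoid.coe_mul, gateU_coe, smul_mul_smul_comm, hs]
  have : (1 + Complex.I • (P : Matrix n n ℂ)) * (1 + Complex.I • (P : Matrix n n ℂ)) =
      (2 * Complex.I : ℂ) • (P : Matrix n n ℂ) := by
    rw [add_mul, mul_add, mul_add, one_mul, one_mul, mul_one, smul_mul_smul_comm, h1,
      Complex.I_mul_I, mul_smul, two_smul]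
    simp [add_comm, add_left_comm]
  rw [this, smul_smul]
  simp [scalarI]

theorem gateU_pow_eight {n : Type*} [Fintype n] [DecidableEq n] (P : Matrix.unitaryGroup n ℂ)
    (hP : P * P = 1) : gateU P hP ^ 8 = 1 := by
  have hI : scalarI n ^ 4 = 1 := by
    apply Subtype.ext
    simp [scalarI, smul_pow]
  have hc : Commute (scalarI n) P := scalarI_mul_comm P
  have hP4 : P ^ 4 = 1 := by
    rw [show 4 = 2 * 2 from rfl, pow_mul, sq P, hP, one_pow]
  rw [show 8 = 2 * 4 from rfl, pow_mul, gateU_sq, hc.mul_pow, hI, hP4, one_mul]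

theorem gateU_conj_of_commute {n : Type*} [Fintype n] [DecidableEq n]
    (P Q : Matrix.unitaryGroup n ℂ) (hP : P * P = 1)
    (h : (P : Matrix n n ℂ) * Q = Q * P) : gateU P hP * Q * (gateU P hP)⁻¹ = Q := by
  rw [mul_inv_eq_iff_eq_mul]
  apply Subtype.ext
  rw [Submonoid.coe_mul, Submonoid.coe_mul, gateU_coe]
  simp [add_mul, mul_add, h]

/-- With the commuting case this shows that the gate of a Pauli involution `P` acts on Pauli
matrices modulo scalars as the symplectic transvection along `P`; in particular it normalizes `E(m)
Y Z₄`. -/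
theorem gateU_conj_of_anticommute {n : Type*} [Fintype n] [DecidableEq n]
    (P Q : Matrix.unitaryGroup n ℂ) (hP : P * P = 1)
    (h : (P : Matrix n n ℂ) * Q = -(Q * P)) :
    gateU P hP * Q * (gateU P hP)⁻¹ = scalarI n * P * Q := by
  have h1 : (P : Matrix n n ℂ) * P = 1 := congrArg Subtype.val hP
  rw [mul_inv_eq_iff_eq_mul]
  apply Subtype.ext
  simp only [Submonoid.coe_mul, gateU_coe, scalarI]
  have h3 : (P : Matrix n n ℂ) * Q * P = -Q := by
    rw [h, neg_mul, mul_assoc, h1, mul_one]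
  simp only [add_mul, mul_add, one_mul, mul_one, smul_mul_assoc, mul_smul_comm, h3, smul_smul]
  simp [add_comm]

theorem gateU_mem {P : Matrix.unitaryGroup (Fin m → ZMod 2) ℂ} (hP : P * P = 1)
    (hmem : P ∈ centralProduct m)
    (h1 : ∀ a, P.1 * (shiftU a).1 = (shiftU a).1 * P.1 ∨
      P.1 * (shiftU a).1 = -((shiftU a).1 * P.1))
    (h2 : ∀ χ, P.1 * (signU χ).1 = (signU χ).1 * P.1 ∨
      P.1 * (signU χ).1 = -((signU χ).1 * P.1))
    (h3 : ∀ v w, P.1 v w ∈ cyclo8) :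
    gateU P hP ∈ complexCliffordGroup m := by
  refine mem_complexCliffordGroup (isOfFinOrder_iff_pow_eq_one.mpr
    ⟨8, by norm_num, gateU_pow_eight P hP⟩) (fun a => ?_) (fun χ => ?_) (fun v w => ?_)
  · rcases h1 a with h | h
    · rw [gateU_conj_of_commute P _ hP h]; exact shiftU_mem a
    · rw [gateU_conj_of_anticommute P _ hP h]
      exact mul_mem (mul_mem scalarI_mem hmem) (shiftU_mem a)
  · rcases h2 χ with h | h
    · rw [gateU_conj_of_commute P _ hP h]; exact signU_mem χ
    · rw [gateU_conj_of_anticommute P _ hP h]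
      exact mul_mem (mul_mem scalarI_mem hmem) (signU_mem χ)
  · rw [gateU_coe]
    refine mul_mem (inv_mem sqrt_two_mem_cyclo8) (add_mem ?_ (mul_mem I_mem_cyclo8 (h3 v w)))
    rw [Matrix.one_apply]
    split_ifs
    · exact one_mem _
    · exact zero_mem _

theorem sgn_mem_cyclo8 (x : ZMod 2) : sgn x ∈ cyclo8 := by
  rw [sgn]
  split_ifs
  · exact one_mem _
  · exact neg_mem (one_mem _)

theorem signU_mul_shiftU (χ : Module.Dual (ZMod 2) (Fin m → ZMod 2)) (a : Fin m → ZMod 2) :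
    (signU χ : Matrix (Fin m → ZMod 2) (Fin m → ZMod 2) ℂ) * shiftU a =
      sgn (χ a) • (shiftU a * signU χ : Matrix (Fin m → ZMod 2) (Fin m → ZMod 2) ℂ) := by
  ext v w
  rw [signU_coe, Matrix.diagonal_mul, Matrix.smul_apply, Matrix.mul_diagonal, shiftU_apply]
  split_ifs with h
  · rw [h, map_add, sgn_add, smul_eq_mul]; ring
  · simp

theorem shiftU_mul_signU (χ : Module.Dual (ZMod 2) (Fin m → ZMod 2)) (a : Fin m → ZMod 2) :
    (shiftU a : Matrix (Fin m → ZMod 2) (Fin m → ZMod 2) ℂ) * signU χ =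
      sgn (χ a) • (signU χ * shiftU a : Matrix (Fin m → ZMod 2) (Fin m → ZMod 2) ℂ) := by
  rw [signU_mul_shiftU, smul_smul, sgn_mul_self, one_smul]

theorem shiftU_mul_self (a : Fin m → ZMod 2) : shiftU a * shiftU a = 1 := by
  rw [← shiftU_add, ZModModule.add_self, shiftU_zero]

theorem signU_mul_self (χ : Module.Dual (ZMod 2) (Fin m → ZMod 2)) : signU χ * signU χ = 1 := by
  rw [← signU_add, ZModModule.add_self, signU_zero]

theorem eq_or_eq_neg_of_sgn_smul {n : Type*} {A B : Matrix n n ℂ} {x : ZMod 2}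
    (h : A = sgn x • B) : A = B ∨ A = -B := by
  rcases zmod_two_cases x with rfl | rfl
  · left; simpa using h
  · right; simpa using h

theorem shiftU_entry_mem (a v w : Fin m → ZMod 2) :
    (shiftU a : Matrix (Fin m → ZMod 2) (Fin m → ZMod 2) ℂ) v w ∈ cyclo8 := by
  rw [shiftU_apply]
  split_ifs
  · exact one_mem _
  · exact zero_mem _

theorem gateU_shiftU_mem (a : Fin m → ZMod 2) :
    gateU (shiftU a) (shiftU_mul_self a) ∈ complexCliffordGroup m := by
  refine gateU_mem _ (shiftU_mem a) (fun b => Or.inl ?_)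
    (fun χ => eq_or_eq_neg_of_sgn_smul (shiftU_mul_signU χ a)) (shiftU_entry_mem a)
  have : shiftU a * shiftU b = shiftU b * shiftU a := by
    rw [← shiftU_add, ← shiftU_add, add_comm]
  exact congrArg Subtype.val this

theorem gateU_signU_mem (χ : Module.Dual (ZMod 2) (Fin m → ZMod 2)) :
    gateU (signU χ) (signU_mul_self χ) ∈ complexCliffordGroup m := by
  refine gateU_mem _ (signU_mem χ)
    (fun a => eq_or_eq_neg_of_sgn_smul (signU_mul_shiftU χ a)) (fun χ' => Or.inl ?_) ?_
  · have : signU χ * signU χ' = signU χ' * signU χ := by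
      rw [← signU_add, ← signU_add, add_comm]
    exact congrArg Subtype.val this
  · intro v w
    rw [signU_coe, Matrix.diagonal_apply]
    split_ifs
    · exact sgn_mem_cyclo8 _
    · exact zero_mem _

theorem permU_mem_of_affine (π : Equiv.Perm (Fin m → ZMod 2))
    (L : (Fin m → ZMod 2) →ₗ[ZMod 2] (Fin m → ZMod 2)) (a : Fin m → ZMod 2)
    (hπ : ∀ v, π v = L v + a) : permU π ∈ complexCliffordGroup m := by
  have hL : Function.Injective L := by
    intro v w h
    exact π.injective (by rw [hπ, hπ, h])
  set e : (Fin m → ZMod 2) ≃ₗ[ZMod 2] (Fin m → ZMod 2) := LinearEquiv.ofInjectiveEndo L hL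
  have he : ∀ v, L (e.symm v) = v := fun v => e.apply_symm_apply v
  refine mem_complexCliffordGroup (isOfFinOrder_permU π) (fun b => ?_) (fun χ => ?_) ?_
  · have : permU π * shiftU b * (permU π)⁻¹ = shiftU (L b) := by
      rw [mul_inv_eq_iff_eq_mul, shiftU, shiftU, ← permU_mul, ← permU_mul]
      congr 1
      ext v : 1
      simp only [Equiv.Perm.mul_apply, Equiv.coe_addRight, hπ, map_add]
      abel
    rw [this]
    exact shiftU_mem _
  -- The translation part `a` contributes the sign `sgn (χ (L⁻¹ a))`; the value `-1` is written as
  -- `(iI)²` so that it visibly lies in `E(m) Y Z₄`.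
  · have : permU π * signU χ = (signU (χ ∘ₗ e.symm.toLinearMap) *
        (if χ (e.symm a) = 0 then 1 else scalarI _ * scalarI _)) * permU π := by
      apply Subtype.ext
      have h : ((if χ (e.symm a) = 0 then 1 else scalarI _ * scalarI _ :
          Matrix.unitaryGroup (Fin m → ZMod 2) ℂ) : Matrix (Fin m → ZMod 2) (Fin m → ZMod 2) ℂ) =
          sgn (χ (e.symm a)) • 1 := by
        rw [sgn]
        split_ifs
        · simp
        · simp [scalarI, smul_smul]
      simp only [Submonoid.coe_mul, h, signU_coe]
      rw [mul_smul_comm, mul_one, smul_mul_assoc]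
      ext v w
      rw [Matrix.mul_diagonal, Matrix.smul_apply, Matrix.diagonal_mul, permU_apply]
      split_ifs with hv
      · have : e.symm v = w + e.symm a := by
          rw [LinearEquiv.symm_apply_eq, map_add, LinearEquiv.apply_symm_apply, hv, hπ]
          rfl
        simp only [LinearMap.comp_apply, LinearEquiv.coe_coe, this, map_add, sgn_add, smul_eq_mul]
        linear_combination (-sgn (χ w)) * sgn_mul_self (χ (e.symm a))
      · simp
    rw [this, mul_inv_cancel_right]
    refine mul_mem (signU_mem _) ?_
    split_ifs
    · exact one_mem _
    · exact mul_mem scalarI_mem scalarI_mem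
  · intro v w
    rw [permU_apply]
    split_ifs
    · exact one_mem _
    · exact zero_mem _

/-! ### Binary codes and Gauss sums -/

section Codes

variable {N : ℕ}

theorem sgn_eq_one_iff {x : ZMod 2} : sgn x = 1 ↔ x = 0 := by
  rcases zmod_two_cases x with rfl | rfl
  · simp
  · simp only [sgn_one, one_ne_zero, iff_false]
    norm_num

theorem sgn_sum {ι : Type*} (s : Finset ι) (f : ι → ZMod 2) :
    sgn (∑ i ∈ s, f i) = ∏ i ∈ s, sgn (f i) := by
  classical
  induction s using Finset.induction_on with
  | empty => simp
  | insert a s ha ih => rw [Finset.sum_insert ha, Finset.prod_insert ha, sgn_add, ih]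

theorem I_pow_hammingNorm (w : Fin N → ZMod 2) :
    Complex.I ^ hammingNorm w = ∏ i, if w i = 0 then 1 else Complex.I := by
  rw [hammingNorm, Finset.prod_ite, Finset.prod_const_one, one_mul, Finset.prod_const]

/-- Since `|w + c| = |w| + |c| - 2 |w ∩ c|`, the correction factor is `i^(-2 |w ∩ c|) = (-1)^(w ·
c)`. Thus the weight modulo 4 is a quadratic refinement of the inner product. -/
theorem I_pow_hammingNorm_add (w c : Fin N → ZMod 2) :
    Complex.I ^ hammingNorm (w + c) =
      Complex.I ^ hammingNorm w * Complex.I ^ hammingNorm c * sgn (w ⬝ᵥ c) := by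
  rw [dotProduct, sgn_sum, I_pow_hammingNorm, I_pow_hammingNorm, I_pow_hammingNorm,
    ← Finset.prod_mul_distrib, ← Finset.prod_mul_distrib]
  refine Finset.prod_congr rfl fun i _ => ?_
  rw [Pi.add_apply]
  rcases zmod_two_cases (w i) with h | h <;> rcases zmod_two_cases (c i) with h' | h' <;>
    simp [h, h', show (1 + 1 : ZMod 2) = 0 from rfl]

theorem I_pow_eq_one_iff {k : ℕ} : Complex.I ^ k = 1 ↔ 4 ∣ k :=
  Complex.isPrimitiveRoot_I.pow_eq_one_iff_dvd k

theorem I_pow_of_mem {D : Submodule (ZMod 2) (Fin N → ZMod 2)} (hD : IsDoublyEven D)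
    {c : Fin N → ZMod 2} (hc : c ∈ D) : Complex.I ^ hammingNorm c = 1 :=
  I_pow_eq_one_iff.mpr (hD c hc)

theorem IsDoublyEven.dotProduct_eq_zero {D : Submodule (ZMod 2) (Fin N → ZMod 2)}
    (hD : IsDoublyEven D) {c c' : Fin N → ZMod 2} (hc : c ∈ D) (hc' : c' ∈ D) : c ⬝ᵥ c' = 0 := by
  have h := I_pow_hammingNorm_add c c'
  rw [I_pow_of_mem hD hc, I_pow_of_mem hD hc', I_pow_of_mem hD (add_mem hc hc'), one_mul,
    one_mul] at h
  exact sgn_eq_one_iff.mp h.symm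

theorem one_mem_of_isSelfDual {C : Submodule (ZMod 2) (Fin N → ZMod 2)} (hC : IsSelfDual C)
    (hD : IsDoublyEven C) : (1 : Fin N → ZMod 2) ∈ C := by
  refine (hC 1).mpr fun c hc => ?_
  rw [← hD.dotProduct_eq_zero hc hc]
  refine Finset.sum_congr rfl fun i _ => ?_
  rcases zmod_two_cases (c i) with h | h <;> simp [h]

open Classical in
theorem sum_sgn_dotProduct (D : Submodule (ZMod 2) (Fin N → ZMod 2)) (w : Fin N → ZMod 2) :
    ∑ c : D, sgn (w ⬝ᵥ (c : Fin N → ZMod 2)) =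
      if ∀ c ∈ D, w ⬝ᵥ c = 0 then (Nat.card D : ℂ) else 0 := by
  split_ifs with h
  · rw [Finset.sum_congr rfl fun c _ => by rw [h c c.2, sgn_zero]]
    simp
  · push Not at h
    obtain ⟨c₀, hc₀, hw⟩ := h
    have h1 : sgn (w ⬝ᵥ c₀) = -1 := by
      rcases zmod_two_cases (w ⬝ᵥ c₀) with h | h
      · exact absurd h hw
      · rw [h, sgn_one]
    have h2 : ∑ c : D, sgn (w ⬝ᵥ (c : Fin N → ZMod 2)) =
        ∑ c : D, sgn (w ⬝ᵥ ((c + ⟨c₀, hc₀⟩ : D) : Fin N → ZMod 2)) :=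
      (Fintype.sum_equiv (Equiv.addRight (⟨c₀, hc₀⟩ : D)) _ _ fun c => rfl).symm
    simp only [Submodule.coe_add, dotProduct_add, sgn_add, h1, mul_neg, mul_one,
      Finset.sum_neg_distrib] at h2
    linear_combination h2 / 2

open Classical in
/-- Weighted sums over the whole space of a function that is invariant under a doubly-even code
only involve the dual code. -/
theorem sum_I_pow_mul (D : Submodule (ZMod 2) (Fin N → ZMod 2)) (hD : IsDoublyEven D)
    (F : (Fin N → ZMod 2) → ℂ) (hF : ∀ w, ∀ c ∈ D, F (w + c) = F w) :
    ∑ w, Complex.I ^ hammingNorm w * F w =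
      ∑ w with ∀ c ∈ D, w ⬝ᵥ c = 0, Complex.I ^ hammingNorm w * F w := by
  have hcard : (Nat.card D : ℂ) ≠ 0 := by exact_mod_cast Nat.card_pos.ne'
  -- Translating `w` by `c ∈ D` multiplies the summand by `(-1)^(w · c)`; averaging over `D`
  -- annihilates all `w` outside the dual.
  have h1 : ∀ c : D, ∑ w, Complex.I ^ hammingNorm w * F w =
      ∑ w, Complex.I ^ hammingNorm w * F w * sgn (w ⬝ᵥ (c : Fin N → ZMod 2)) := by
    intro c
    refine (Fintype.sum_equiv (Equiv.addRight (c : Fin N → ZMod 2)) _ _ fun w => ?_).symm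
    rw [Equiv.coe_addRight, hF w c c.2, I_pow_hammingNorm_add, I_pow_of_mem hD c.2]
    ring
  have h2 : (Nat.card D : ℂ) * ∑ w, Complex.I ^ hammingNorm w * F w =
      ∑ w, Complex.I ^ hammingNorm w * F w *
        ∑ c : D, sgn (w ⬝ᵥ (c : Fin N → ZMod 2)) := by
    simp only [Finset.mul_sum]
    rw [Finset.sum_comm, ← Finset.mul_sum, Finset.sum_congr rfl fun c _ => (h1 c).symm]
    simp
  refine mul_left_cancel₀ hcard (h2.trans ?_)
  rw [Finset.sum_filter, Finset.mul_sum]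
  refine Finset.sum_congr rfl fun w _ => ?_
  rw [sum_sgn_dotProduct]
  split_ifs <;> ring

theorem sum_I_pow_hammingNorm :
    ∑ w : Fin N → ZMod 2, Complex.I ^ hammingNorm w = (1 + Complex.I) ^ N := by
  simp only [I_pow_hammingNorm]
  rw [sum_prod_eq_prod_sum (fun (_ : Fin N) (x : ZMod 2) => if x = 0 then 1 else Complex.I)]
  have : ∑ x : ZMod 2, (if x = 0 then 1 else Complex.I) = 1 + Complex.I := by
    rw [show (Finset.univ : Finset (ZMod 2)) = {0, 1} from rfl]
    simp
  rw [Finset.prod_congr rfl fun _ _ => this]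
  simp

-- The Gauss sum `∑ i^|w|` factors over the coordinates as `(1 + i)^N`, while only the words of `C^⊥
-- = C` contribute to it, each with value 1.
open Classical in
theorem one_add_I_pow_eq_card {C : Submodule (ZMod 2) (Fin N → ZMod 2)} (hC : IsSelfDual C)
    (hD : IsDoublyEven C) : (1 + Complex.I) ^ N = Nat.card C := by
  have h := sum_I_pow_mul C hD (fun _ => 1) fun _ _ _ => rfl
  simp only [mul_one] at h
  rw [sum_I_pow_hammingNorm, Finset.sum_congr (Finset.filter_congr fun w _ => (hC w).symm)
    fun _ _ => rfl, Finset.sum_congr rfl fun w hw => I_pow_of_mem hD (Finset.mem_filter.mp hw).2]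
    at h
  rw [h]
  simp [Fintype.card_subtype]

/-- The number `(1 + i)^N = √2^N ζ₈^N` is the cardinality of `C`, hence positive, so its phase
`ζ₈^N` is 1. -/
theorem eight_dvd_of_isSelfDual {C : Submodule (ZMod 2) (Fin N → ZMod 2)} (hC : IsSelfDual C)
    (hD : IsDoublyEven C) : 8 ∣ N := by
  rw [← zeta8_isPrimitiveRoot.pow_eq_one_iff_dvd]
  have h := one_add_I_pow_eq_card hC hD
  rw [← sqrt_two_mul_zeta8, mul_pow] at h
  have h1 : ‖zeta8 ^ N‖ = 1 := by
    rw [norm_pow, zeta8_isPrimitiveRoot.norm'_eq_one (by norm_num), one_pow]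
  have h2 : (Real.sqrt 2 : ℂ) ^ N = Nat.card C := by
    have := congrArg norm h
    rw [norm_mul, h1, mul_one, norm_pow, Complex.norm_real, Real.norm_of_nonneg (by positivity),
      Complex.norm_natCast] at this
    exact_mod_cast this
  rw [h2] at h
  exact mul_left_cancel₀ (by exact_mod_cast Nat.card_pos.ne') (h.trans (mul_one _).symm)

theorem sum_sgn_dotProduct_univ (c : Fin N → ZMod 2) :
    ∑ w : Fin N → ZMod 2, sgn (w ⬝ᵥ c) = if c = 0 then 2 ^ N else 0 := by
  classical
  have h3 := sum_sgn_dotProduct (⊤ : Submodule (ZMod 2) (Fin N → ZMod 2)) c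
  have h4 : (∀ c' ∈ (⊤ : Submodule (ZMod 2) (Fin N → ZMod 2)), c ⬝ᵥ c' = 0) ↔ c = 0 :=
    ⟨fun h => funext fun i => by simpa using h (Pi.single i 1) trivial, fun h => by simp [h]⟩
  rw [if_congr h4 rfl rfl] at h3
  have h5 : ∑ w : Fin N → ZMod 2, sgn (w ⬝ᵥ c) =
      ∑ w : (⊤ : Submodule (ZMod 2) (Fin N → ZMod 2)), sgn (c ⬝ᵥ (w : Fin N → ZMod 2)) :=
    (Fintype.sum_equiv (Submodule.topEquiv (R := ZMod 2) (M := Fin N → ZMod 2)).toEquiv _ _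
      fun w => by rw [dotProduct_comm]; rfl).symm
  rw [h5, h3]
  simp

-- Double counting of `∑ (-1)^(w · c)` over all `w` and all `c ∈ D`.
open Classical in
theorem card_mul_card_dual (D : Submodule (ZMod 2) (Fin N → ZMod 2)) :
    Nat.card D * (Finset.univ.filter fun w : Fin N → ZMod 2 => ∀ c ∈ D, w ⬝ᵥ c = 0).card =
      2 ^ N := by
  have h1 : ∑ w : Fin N → ZMod 2, ∑ c : D, sgn (w ⬝ᵥ (c : Fin N → ZMod 2)) =
      (Nat.card D * (Finset.univ.filter fun w : Fin N → ZMod 2 => ∀ c ∈ D, w ⬝ᵥ c = 0).card : ℂ) :=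
    by
      rw [Finset.sum_congr rfl fun w _ => sum_sgn_dotProduct D w, ← Finset.sum_filter]
      simp [mul_comm]
  rw [Finset.sum_comm, Finset.sum_congr rfl fun (c : D) _ => 
    sum_sgn_dotProduct_univ (c : Fin N → ZMod 2)] at h1
  have h6 : ∑ c : D, (if (c : Fin N → ZMod 2) = 0 then (2 : ℂ) ^ N else 0) = 2 ^ N := by
    rw [Finset.sum_eq_single (0 : D)]
    · simp
    · intro c _ hc
      rw [if_neg]
      exact fun h => hc (Subtype.ext h)
    · simp
  rw [h6] at h1
  exact_mod_cast h1.symm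

/-! ### Enumerators -/

open Classical in
/-- The indicator function of the tuples of codewords of `D`, written as columns. -/
def psi (m : ℕ) (D : Submodule (ZMod 2) (Fin N → ZMod 2)) (A : Fin N → Fin m → ZMod 2) : ℂ :=
  if ∀ j, (fun i => A i j) ∈ D then 1 else 0

theorem mem_extendScalars_iff {m : ℕ} {F : Type*} [Field F] [Algebra (ZMod 2) F]
    (b : Module.Basis (Fin m) (ZMod 2) F) (C : Submodule (ZMod 2) (Fin N → ZMod 2))
    (x : Fin N → F) :
    x ∈ extendScalars F C ↔ ∀ j, (fun i => b.equivFun (x i) j) ∈ C := by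
  constructor
  · intro hx
    -- Coordinates are replaced by arbitrary functionals, so that the induction survives scalars `a
    -- ∈ F`: the map `x ↦ χ (a x)` is again a functional.
    suffices h : ∀ χ : Module.Dual (ZMod 2) F, (fun i => χ (x i)) ∈ C from
      fun j => h (LinearMap.proj j ∘ₗ b.equivFun.toLinearMap)
    refine Submodule.span_induction ?_ ?_ ?_ ?_ hx
    · rintro _ ⟨c, hc, rfl⟩ χ
      have : (fun i => χ (algebraMap (ZMod 2) F (c i))) = χ 1 • c := by
        funext i
        rw [Algebra.algebraMap_eq_smul_one, map_smul, Pi.smul_apply, smul_eq_mul, smul_eq_mul,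
          mul_comm]
      rw [this]
      exact C.smul_mem _ hc
    · intro χ
      simp only [Pi.zero_apply, map_zero]
      exact zero_mem C
    · intro x y _ _ hx hy χ
      simp only [Pi.add_apply, map_add]
      exact add_mem (hx χ) (hy χ)
    · intro a x _ hx χ
      exact hx (χ ∘ₗ LinearMap.mulLeft (ZMod 2) a)
  · intro h
    have hx : x = ∑ j, b j • fun i => algebraMap (ZMod 2) F (b.equivFun (x i) j) := by
      funext i
      rw [Finset.sum_apply]
      conv_lhs => rw [← b.sum_equivFun (x i)]
      refine Finset.sum_congr rfl fun j _ => ?_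
      rw [Pi.smul_apply, smul_eq_mul, Algebra.smul_def, mul_comm]
    rw [hx]
    exact sum_mem fun j _ => Submodule.smul_mem _ _ (Submodule.subset_span ⟨_, h j, rfl⟩)

theorem rename_cwe_extendScalars {m : ℕ} {F : Type*} [Field F] [Fintype F] [Algebra (ZMod 2) F]
    (b : Module.Basis (Fin m) (ZMod 2) F) (C : Submodule (ZMod 2) (Fin N → ZMod 2)) :
    MvPolynomial.rename b.equivFun (cwe (extendScalars F C)) = toPoly (psi m C) := by
  classical
  have h : ∀ c : Fin N → F, ∏ f : F, (MvPolynomial.X f : MvPolynomial F ℂ) ^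
      Finset.card {i : Fin N | c i = f} = ∏ i, MvPolynomial.X (c i) := by
    intro c
    rw [← Finset.prod_fiberwise Finset.univ c fun i => (MvPolynomial.X (c i) : MvPolynomial F ℂ)]
    refine Finset.prod_congr rfl fun f _ => ?_
    rw [Finset.prod_congr rfl (g := fun _ => MvPolynomial.X f), Finset.prod_const]
    intro i hi
    rw [(Finset.mem_filter.mp hi).2]
  rw [cwe, toPoly_apply, Finset.sum_filter, map_sum]
  refine Fintype.sum_equiv (Equiv.piCongrRight fun _ => b.equivFun.toEquiv) _ _ fun c => ?_
  rw [monomial_mono, psi]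
  change _ = MvPolynomial.C (if ∀ j, (fun i => b.equivFun (c i) j) ∈ C then 1 else 0) *
    ∏ i, MvPolynomial.X (b.equivFun (c i))
  have h2 := mem_extendScalars_iff b C c
  by_cases hc : c ∈ extendScalars F C
  · rw [if_pos hc, if_pos (h2.mp hc)]
    rw [map_one, one_mul]
    refine Eq.trans ?_ (show MvPolynomial.rename b.equivFun (∏ i, MvPolynomial.X (c i)) = _ by
      simp [map_prod])
    congr 1
    refine Eq.trans ?_ (h c)
    congr!
  · rw [if_neg hc, if_neg fun h => hc (h2.mpr h)]
    simp

end Codes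

/-! ### Invariance of the enumerators of self-dual codes -/

section Forward

variable {m N : ℕ}

theorem tact_of_shift {M : Fin N → Matrix (Fin m → ZMod 2) (Fin m → ZMod 2) ℂ}
    {s : Fin N → Fin m → ZMod 2} (hM : ∀ i v w, M i v w = if v = w + s i then 1 else 0)
    (f : (Fin N → Fin m → ZMod 2) → ℂ) (B : Fin N → Fin m → ZMod 2) :
    tact M f B = f (B + s) := by
  rw [tact_apply]
  have h : ∀ A : Fin N → Fin m → ZMod 2, ∏ i, M i (B i) (A i) =
      if A = B + s then 1 else 0 := by
    intro A
    simp only [hM]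
    rw [Finset.prod_ite_zero]
    simp only [Finset.prod_const_one, Finset.mem_univ, true_imp_iff]
    refine if_congr ?_ rfl rfl
    rw [funext_iff]
    refine forall_congr' fun i => ?_
    rw [Pi.add_apply, ← sub_eq_iff_eq_add, ZModModule.sub_eq_add, eq_comm]
  simp [h]

theorem tact_of_diagonal {M : Fin N → Matrix (Fin m → ZMod 2) (Fin m → ZMod 2) ℂ}
    {d : Fin N → (Fin m → ZMod 2) → ℂ} (hM : ∀ i, M i = Matrix.diagonal (d i))
    (f : (Fin N → Fin m → ZMod 2) → ℂ) (B : Fin N → Fin m → ZMod 2) :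
    tact M f B = (∏ i, d i (B i)) * f B := by
  rw [tact_apply, Finset.sum_eq_single B]
  · simp [hM]
  · intro A _ hA
    obtain ⟨i, hi⟩ := Function.ne_iff.mp hA
    rw [Finset.prod_eq_zero (Finset.mem_univ i), zero_mul]
    rw [hM, Matrix.diagonal_apply_ne _ hi.symm]
  · simp

/-- The families of unitary matrices whose tensor product fixes `f`. -/
def tensorStabilizer (f : (Fin N → Fin m → ZMod 2) → ℂ) :
    Subgroup (Fin N → Matrix.unitaryGroup (Fin m → ZMod 2) ℂ) where
  carrier := {M | tact (fun i => (M i).1) f = f}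
  mul_mem' {M M'} h h' := by
    have h1 : tact (fun i => (M i).1) f = f := h
    have h2 : tact (fun i => (M' i).1) f = f := h'
    change tact (fun i => (M i).1 * (M' i).1) f = f
    rw [tact_mul, h2, h1]
  one_mem' := tact_one f
  inv_mem' {M} h := by
    have h1 : tact (fun i => ((M⁻¹ * M) i).1) f =
        tact (fun i => ((M⁻¹) i).1) (tact (fun i => (M i).1) f) :=
      tact_mul _ _ f
    rw [inv_mul_cancel, h] at h1
    exact h1.symm.trans (tact_one f)

theorem mem_tensorStabilizer {f : (Fin N → Fin m → ZMod 2) → ℂ}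
    {M : Fin N → Matrix.unitaryGroup (Fin m → ZMod 2) ℂ} :
    M ∈ tensorStabilizer f ↔ tact (fun i => (M i).1) f = f := Iff.rfl

/-- The family that consists of `g` on the support of `c` and of `1` elsewhere. -/
def powFamily {G : Type*} [Group G] (c : Fin N → ZMod 2) : G →* (Fin N → G) where
  toFun g i := if c i = 0 then 1 else g
  map_one' := by funext i; simp
  map_mul' g h := by
    funext i
    rw [Pi.mul_apply]
    split_ifs <;> simp

theorem powFamily_apply {G : Type*} [Group G] (c : Fin N → ZMod 2) (g : G) (i : Fin N) :
    powFamily c g i = if c i = 0 then 1 else g := rfl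

theorem dual_comp_mem {D : Submodule (ZMod 2) (Fin N → ZMod 2)} {A : Fin N → Fin m → ZMod 2}
    (h : ∀ j, (fun i => A i j) ∈ D) (χ : Module.Dual (ZMod 2) (Fin m → ZMod 2)) :
    (fun i => χ (A i)) ∈ D := by
  have : (fun i => χ (A i)) = ∑ j, χ (Pi.single j 1) • fun i => A i j := by
    funext i
    conv_lhs => rw [dual_eq_sum χ]
    simp
  rw [this]
  exact sum_mem fun j _ => D.smul_mem _ (h j)

theorem tact_powFamily_shiftU (c : Fin N → ZMod 2) (a : Fin m → ZMod 2)
    (f : (Fin N → Fin m → ZMod 2) → ℂ) (B : Fin N → Fin m → ZMod 2) :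
    tact (fun i => (powFamily c (shiftU a) i).1) f B = f (B + fun i => c i • a) := by
  refine tact_of_shift (fun i v w => ?_) f B
  rw [powFamily_apply]
  rcases zmod_two_cases (c i) with h | h
  · simp [h, Matrix.one_apply]
  · simp [h, shiftU_apply]

theorem tact_powFamily_signU (c : Fin N → ZMod 2) (χ : Module.Dual (ZMod 2) (Fin m → ZMod 2))
    (f : (Fin N → Fin m → ZMod 2) → ℂ) (B : Fin N → Fin m → ZMod 2) :
    tact (fun i => (powFamily c (signU χ) i).1) f B =
      sgn (c ⬝ᵥ fun i => χ (B i)) * f B := by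
  rw [tact_of_diagonal (d := fun i v => sgn (c i * χ v)), dotProduct, sgn_sum]
  intro i
  rw [powFamily_apply]
  rcases zmod_two_cases (c i) with h | h
  · simp [h]
  · simp [h, signU_coe]

theorem psi_add_smul {C : Submodule (ZMod 2) (Fin N → ZMod 2)} {c : Fin N → ZMod 2} (hc : c ∈ C)
    (a : Fin m → ZMod 2) (B : Fin N → Fin m → ZMod 2) :
    psi m C (B + fun i => c i • a) = psi m C B := by
  classical
  refine if_congr (forall_congr' fun j => ?_) rfl rfl
  have : (fun i => (B + fun i => c i • a : Fin N → Fin m → ZMod 2) i j) =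
      (fun i => B i j) + a j • c := by
    funext i
    simp [mul_comm]
  rw [this]
  exact C.add_mem_iff_left (C.smul_mem _ hc)

/-- On generators: shifts add multiples of `c ∈ C` to the rows; sign matrices contribute `(-1)^(c ·
x)` with `x ∈ C`, which is 1 by self-orthogonality; the scalar `i` contributes `i^|c| = 1` by double
evenness. -/
theorem powFamily_mem_tensorStabilizer {C : Submodule (ZMod 2) (Fin N → ZMod 2)}
    (hD : IsDoublyEven C) {c : Fin N → ZMod 2} (hc : c ∈ C)
    {Q : Matrix.unitaryGroup (Fin m → ZMod 2) ℂ} (hQ : Q ∈ centralProduct m) :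
    powFamily c Q ∈ tensorStabilizer (psi m C) := by
  suffices h : centralProduct m ≤ (tensorStabilizer (psi m C)).comap (powFamily c) from h hQ
  refine centralProduct_le (fun a => ?_) (fun χ => ?_) ?_
  · refine mem_tensorStabilizer.mpr (funext fun B => ?_)
    rw [tact_powFamily_shiftU, psi_add_smul hc]
  · refine mem_tensorStabilizer.mpr (funext fun B => ?_)
    rw [tact_powFamily_signU]
    by_cases hB : ∀ j, (fun i => B i j) ∈ C
    · rw [hD.dotProduct_eq_zero hc (dual_comp_mem hB χ), sgn_zero, one_mul]
    · rw [psi, if_neg hB, mul_zero]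
  · refine mem_tensorStabilizer.mpr (funext fun B => ?_)
    rw [tact_of_diagonal (d := fun i _ => if c i = 0 then 1 else Complex.I),
      ← I_pow_hammingNorm, I_pow_of_mem hD hc, one_mul]
    intro i
    rw [powFamily_apply]
    split_ifs
    · simp
    · exact Matrix.smul_one_eq_diagonal Complex.I

theorem psi_of_mem {C : Submodule (ZMod 2) (Fin N → ZMod 2)} {A : Fin N → Fin m → ZMod 2}
    (h : ∀ j, (fun i => A i j) ∈ C) : psi m C A = 1 := if_pos h

theorem psi_zero (C : Submodule (ZMod 2) (Fin N → ZMod 2)) : psi m C 0 = 1 :=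
  psi_of_mem fun _ => zero_mem C

theorem apply_eq_apply_zero {C : Submodule (ZMod 2) (Fin N → ZMod 2)}
    {f : (Fin N → Fin m → ZMod 2) → ℂ}
    (hf : ∀ c ∈ C, ∀ (a : Fin m → ZMod 2) B, f (B + fun i => c i • a) = f B)
    {B : Fin N → Fin m → ZMod 2} (hB : ∀ j, (fun i => B i j) ∈ C) : f B = f 0 := by
  have h : ∀ s : Finset (Fin m),
      f (∑ j ∈ s, fun i => B i j • (Pi.single j 1 : Fin m → ZMod 2)) = f 0 := by
    intro s
    induction s using Finset.induction_on with
    | empty => simp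
    | insert j s hj ih => rw [Finset.sum_insert hj, add_comm, hf _ (hB j), ih]
  rw [← h Finset.univ]
  congr 1
  funext i k
  simp [Finset.sum_apply, Pi.single_apply]

/-- Invariance under the shifts makes `f` constant on arrays with rows in `C`; invariance under the
signs makes it vanish unless all rows lie in `C^⊥ = C`. -/
theorem eq_smul_psi {C : Submodule (ZMod 2) (Fin N → ZMod 2)} (hC : IsSelfDual C)
    {f : (Fin N → Fin m → ZMod 2) → ℂ}
    (hf : ∀ c ∈ C, ∀ Q ∈ centralProduct m, powFamily c Q ∈ tensorStabilizer f) :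
    f = f 0 • psi m C := by
  funext B
  rw [Pi.smul_apply, smul_eq_mul]
  by_cases hB : ∀ j, (fun i => B i j) ∈ C
  · rw [psi_of_mem hB, mul_one]
    refine apply_eq_apply_zero (fun c hc a B => ?_) hB
    rw [← tact_powFamily_shiftU c a f B, mem_tensorStabilizer.mp (hf c hc _ (shiftU_mem a))]
  · rw [psi, if_neg hB, mul_zero]
    by_contra h0
    refine hB fun j => (hC _).mpr fun c hc => ?_
    have h := congrFun (mem_tensorStabilizer.mp (hf c hc _ (signU_mem (LinearMap.proj j)))) B
    rw [tact_powFamily_signU] at h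
    rw [dotProduct_comm]
    exact sgn_eq_one_iff.mp (mul_right_cancel₀ h0 (h.trans (one_mul _).symm))

theorem tact_psi_eq_smul {C : Submodule (ZMod 2) (Fin N → ZMod 2)} (hC : IsSelfDual C)
    (hD : IsDoublyEven C) {g : Matrix.unitaryGroup (Fin m → ZMod 2) ℂ}
    (hg : g ∈ Subgroup.normalizer (centralProduct m : Set _)) :
    ∃ l : ℂ, tact (fun _ => g.1) (psi m C) = l • psi m C := by
  refine ⟨_, eq_smul_psi hC fun c hc Q hQ => ?_⟩
  have h1 : g⁻¹ * Q * g ∈ centralProduct m := by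
    have := (Subgroup.mem_normalizer_iff.mp (inv_mem hg) Q).mp hQ
    simpa using this
  have h2 := mem_tensorStabilizer.mp (powFamily_mem_tensorStabilizer hD hc h1)
  rw [mem_tensorStabilizer, ← tact_mul]
  conv_rhs => rw [← h2]
  rw [← tact_mul]
  congr 2
  funext i
  -- Moving the operator past `g^{⊗N}` replaces `Q` by a conjugate, which already fixes `psi m C`.
  have : powFamily c Q i * g = g * powFamily c (g⁻¹ * Q * g) i := by
    rw [powFamily_apply, powFamily_apply]
    split_ifs
    · simp
    · simp [mul_assoc]
  exact congrArg Subtype.val this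

/-! ### Rows of an element of the normalizer -/

/-- The matrix `Q` maps `e_u` to a multiple of `e_{u + v}`, for all `u`. -/
def HasShift (v : Fin m → ZMod 2) (Q : Matrix.unitaryGroup (Fin m → ZMod 2) ℂ) : Prop :=
  ∀ w u, Q.1 w u ≠ 0 → w = u + v

theorem HasShift.mul {v v' : Fin m → ZMod 2} {Q Q' : Matrix.unitaryGroup (Fin m → ZMod 2) ℂ}
    (h : HasShift v Q) (h' : HasShift v' Q') : HasShift (v + v') (Q * Q') := by
  intro w u hwu
  rw [Submonoid.coe_mul, Matrix.mul_apply] at hwu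
  obtain ⟨x, _, hx⟩ := Finset.exists_ne_zero_of_sum_ne_zero hwu
  rw [h _ _ (left_ne_zero_of_mul hx), h' _ _ (right_ne_zero_of_mul hx)]
  abel

theorem hasShift_one : HasShift (m := m) 0 1 := by
  intro w u h
  rw [Submonoid.coe_one, Matrix.one_apply] at h
  simpa using h

theorem HasShift.inv {v : Fin m → ZMod 2} {Q : Matrix.unitaryGroup (Fin m → ZMod 2) ℂ}
    (h : HasShift v Q) : HasShift v Q⁻¹ := by
  intro w u hwu
  have h1 : star (Q.1 u w) ≠ 0 := hwu
  rw [h _ _ (star_ne_zero.mp h1), add_assoc, ZModModule.add_self, add_zero]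

theorem exists_hasShift {Q : Matrix.unitaryGroup (Fin m → ZMod 2) ℂ}
    (hQ : Q ∈ centralProduct m) : ∃ v, HasShift v Q := by
  let K : Subgroup (Matrix.unitaryGroup (Fin m → ZMod 2) ℂ) :=
    { carrier := {Q | ∃ v, HasShift v Q}
      mul_mem' := fun ⟨v, hv⟩ ⟨v', hv'⟩ => ⟨v + v', hv.mul hv'⟩
      one_mem' := ⟨0, hasShift_one⟩
      inv_mem' := fun ⟨v, hv⟩ => ⟨v, hv.inv⟩ }
  have hK : centralProduct m ≤ K := by
    refine centralProduct_le (fun a => ⟨a, fun w u h => ?_⟩) (fun χ => ⟨0, fun w u h => ?_⟩)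
      ⟨0, fun w u h => ?_⟩
    · rw [shiftU_apply] at h
      by_contra h'
      exact h (if_neg h')
    · rw [signU_coe] at h
      by_contra h'
      exact h (Matrix.diagonal_apply_ne _ fun h => h' (by rw [h, add_zero]))
    · by_contra h'
      refine h ?_
      rw [add_zero] at h'
      simp [scalarI, Matrix.one_apply_ne h']
  exact hK hQ

/-- The elements of `E(m) Y Z₄` that fix the row vector `φ`. -/
def rowStabilizer (φ : (Fin m → ZMod 2) → ℂ) :
    Subgroup (Matrix.unitaryGroup (Fin m → ZMod 2) ℂ) where
  carrier := {Q | Q ∈ centralProduct m ∧ Matrix.vecMul φ Q.1 = φ}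
  mul_mem' {Q Q'} h h' := ⟨mul_mem h.1 h'.1, by
    rw [Submonoid.coe_mul, ← Matrix.vecMul_vecMul, h.2, h'.2]⟩
  one_mem' := ⟨one_mem _, by simp⟩
  inv_mem' {Q} h := ⟨inv_mem h.1, by
    have h1 : Q.1 * (Q⁻¹ : Matrix.unitaryGroup (Fin m → ZMod 2) ℂ).1 = 1 :=
      congrArg Subtype.val (mul_inv_cancel Q)
    conv_lhs => rw [← h.2]
    rw [Matrix.vecMul_vecMul, h1, Matrix.vecMul_one]⟩

/-- The dual vector `v ↦ b ⬝ᵥ v`. -/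
def dotDual (b : Fin m → ZMod 2) : Module.Dual (ZMod 2) (Fin m → ZMod 2) :=
  ∑ j, b j • LinearMap.proj j

theorem dotDual_apply (b v : Fin m → ZMod 2) : dotDual b v = b ⬝ᵥ v := by
  simp [dotDual, dotProduct]

/-- If `Z` is diagonal with entry 1 at `w₀`, then `g⁻¹ Z g` fixes the row `w₀` of `g`. Such
conjugates of sign matrices supply `Q`; one of them has shift `v`, as otherwise Fourier inversion
would make the product of the entries at `v` and `0` vanish. -/
theorem exists_rowStabilizer_hasShift {g : Matrix.unitaryGroup (Fin m → ZMod 2) ℂ}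
    (hg : g ∈ Subgroup.normalizer (centralProduct m : Set _)) {w₀ v : Fin m → ZMod 2}
    (h0 : g.1 w₀ 0 ≠ 0) (hv : g.1 w₀ v ≠ 0) :
    ∃ Q ∈ rowStabilizer (g.1 w₀), HasShift v Q := by
  have h1 : ∃ b : Fin m → ZMod 2,
      ((g⁻¹ * signU (dotDual b) * g : Matrix.unitaryGroup _ ℂ)).1 v 0 ≠ 0 := by
    by_contra! hcon
    -- Weighting by `sgn (b ⬝ᵥ w₀)` and summing over `b` isolates the term `w = w₀` of the matrix
    -- entry.
    have h2 : ∑ b : Fin m → ZMod 2, sgn (b ⬝ᵥ w₀) *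
        ((g⁻¹ * signU (dotDual b) * g : Matrix.unitaryGroup _ ℂ)).1 v 0 = 0 :=
      Finset.sum_eq_zero fun b _ => by rw [hcon b, mul_zero]
    have h3 : ∀ b : Fin m → ZMod 2,
        ((g⁻¹ * signU (dotDual b) * g : Matrix.unitaryGroup _ ℂ)).1 v 0 =
          ∑ w, star (g.1 w v) * sgn (b ⬝ᵥ w) * g.1 w 0 := by
      intro b
      rw [Submonoid.coe_mul, Submonoid.coe_mul, signU_coe, Matrix.mul_apply]
      refine Finset.sum_congr rfl fun w _ => ?_
      rw [Matrix.mul_diagonal, dotDual_apply]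
      rfl
    simp only [h3, Finset.mul_sum] at h2
    rw [Finset.sum_comm] at h2
    have h4 : ∀ w : Fin m → ZMod 2, ∑ b : Fin m → ZMod 2, sgn (b ⬝ᵥ w₀) *
        (star (g.1 w v) * sgn (b ⬝ᵥ w) * g.1 w 0) =
          if w = w₀ then 2 ^ m * (star (g.1 w v) * g.1 w 0)
          else 0 := by
      intro w
      have h5 : w + w₀ = 0 ↔ w = w₀ := by
        rw [← ZModModule.sub_eq_add, sub_eq_zero]
      have h6 := sum_sgn_dotProduct_univ (w + w₀)
      simp only [dotProduct_add, sgn_add, h5] at h6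
      calc _ = (∑ b : Fin m → ZMod 2, sgn (b ⬝ᵥ w) * sgn (b ⬝ᵥ w₀)) *
            (star (g.1 w v) * g.1 w 0) := by
              rw [Finset.sum_mul]
              exact Finset.sum_congr rfl fun b _ => by ring
        _ = _ := by rw [h6]; split_ifs <;> simp
    simp only [h4, Finset.sum_ite_eq', Finset.mem_univ, if_true] at h2
    exact mul_ne_zero (pow_ne_zero _ two_ne_zero) (mul_ne_zero (star_ne_zero.mpr hv) h0) h2
  obtain ⟨b, hb⟩ := h1
  have key : ∀ Z ∈ centralProduct m, ∀ d : (Fin m → ZMod 2) → ℂ,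
      Z.1 = Matrix.diagonal d → d w₀ = 1 →
      ((g⁻¹ * Z * g : Matrix.unitaryGroup _ ℂ)).1 v 0 ≠ 0 →
      ∃ Q ∈ rowStabilizer (g.1 w₀), HasShift v Q := by
    intro Z hZ d hZd hd hne
    have hmem : g⁻¹ * Z * g ∈ centralProduct m := by
      have := (Subgroup.mem_normalizer_iff.mp (inv_mem hg) Z).mp hZ
      simpa using this
    refine ⟨_, ⟨hmem, ?_⟩, ?_⟩
    · rw [← Matrix.mul_apply_eq_vecMul, ← Submonoid.coe_mul, ← mul_assoc, ← mul_assoc,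
        mul_inv_cancel, one_mul, Submonoid.coe_mul, hZd]
      funext u
      rw [Matrix.diagonal_mul, hd, one_mul]
    · obtain ⟨v', hv'⟩ := exists_hasShift hmem
      have := hv' _ _ hne
      rw [zero_add] at this
      rwa [this]
  rcases zmod_two_cases (dotDual b w₀) with h | h
  · exact key _ (signU_mem _) _ (signU_coe _) (by rw [h, sgn_zero]) hb
  -- Here the sign matrix has entry `-1` at `w₀`; its negative `(iI)² Z` is used instead.
  · refine key (scalarI _ * scalarI _ * signU (dotDual b))
      (mul_mem (mul_mem scalarI_mem scalarI_mem) (signU_mem _))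
      (fun u => -sgn (dotDual b u)) ?_ (by rw [h, sgn_one, neg_neg]) ?_
    · rw [Submonoid.coe_mul, Submonoid.coe_mul, signU_coe]
      simp [scalarI, smul_smul, Matrix.diagonal_neg]
    · have : g⁻¹ * (scalarI _ * scalarI _ * signU (dotDual b)) * g =
          scalarI _ * scalarI _ * (g⁻¹ * signU (dotDual b) * g) := by
        rw [mul_assoc (scalarI _), ← mul_assoc g⁻¹, ← scalarI_mul_comm, mul_assoc (scalarI _) g⁻¹,
          ← mul_assoc g⁻¹ (scalarI _), ← scalarI_mul_comm]
        simp only [mul_assoc]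
      rw [this, Submonoid.coe_mul, Submonoid.coe_mul]
      have h2 : ((scalarI (Fin m → ZMod 2)).1 * (scalarI (Fin m → ZMod 2)).1) =
          -1 := by
        simp [scalarI, smul_smul]
      rw [h2, neg_mul, one_mul, Matrix.neg_apply]
      exact neg_ne_zero.mpr hb

theorem rowStabilizer_apply_zero {φ : (Fin m → ZMod 2) → ℂ} {v : Fin m → ZMod 2}
    {Q : Matrix.unitaryGroup (Fin m → ZMod 2) ℂ} (hQ : Q ∈ rowStabilizer φ) (hs : HasShift v Q) :
    φ 0 = φ v * Q.1 v 0 := by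
  conv_lhs => rw [← hQ.2]
  rw [Matrix.vecMul, dotProduct, Finset.sum_eq_single v]
  · intro u _ hu
    by_contra h
    have := hs u 0 (right_ne_zero_of_mul h)
    rw [zero_add] at this
    exact hu this
  · simp

theorem norm_of_hasShift {v : Fin m → ZMod 2}
    {Q : Matrix.unitaryGroup (Fin m → ZMod 2) ℂ} (hs : HasShift v Q) :
    ‖Q.1 v 0‖ = 1 := by
  have h := congrFun (congrFun (Matrix.mem_unitaryGroup_iff'.mp Q.2) 0) 0
  rw [Matrix.mul_apply, Finset.sum_eq_single v, Matrix.one_apply_eq, Matrix.star_apply] at h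
  · have := congrArg norm h
    rw [norm_mul, norm_star, norm_one] at this
    nlinarith [norm_nonneg (Q.1 v 0)]
  · intro u _ hu
    by_contra h
    have := hs u 0 (right_ne_zero_of_mul h)
    rw [zero_add] at this
    exact hu this
  · simp

/-- The space of translation parts of the stabilizer of a row vector. -/
def shiftSpace (φ : (Fin m → ZMod 2) → ℂ) : Submodule (ZMod 2) (Fin m → ZMod 2) where
  carrier := {v | ∃ Q ∈ rowStabilizer φ, HasShift v Q}
  add_mem' := fun ⟨Q, hQ, h⟩ ⟨Q', hQ', h'⟩ => ⟨Q * Q', mul_mem hQ hQ', h.mul h'⟩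
  zero_mem' := ⟨1, one_mem _, hasShift_one⟩
  smul_mem' := by
    rintro a v ⟨Q, hQ, h⟩
    rcases zmod_two_cases a with rfl | rfl
    · rw [zero_smul]
      exact ⟨1, one_mem _, hasShift_one⟩
    · rw [one_smul]
      exact ⟨Q, hQ, h⟩

/-- One matrix `Q_j` is chosen per row, not per position, and is applied on the support of row `j`.
The composite family `M` fixes `psi m C`, while `M i` fixes `φ` and carries `e_0` to a multiple of
`e_{A i}`. The first property makes the product of these multiples 1; the second turns `∏ φ (A i)`
into `φ(0)^N`. -/
theorem prod_apply_eq_pow {C : Submodule (ZMod 2) (Fin N → ZMod 2)} (hD : IsDoublyEven C)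
    {φ : (Fin m → ZMod 2) → ℂ} {A : Fin N → Fin m → ZMod 2} (hA : ∀ j, (fun i => A i j) ∈ C)
    (hAU : ∀ i, A i ∈ shiftSpace φ) : ∏ i, φ (A i) = φ 0 ^ N := by
  -- Projecting the standard basis into the subspace expresses every `A i` through vectors of the
  -- subspace with the entries `A i j` still as coefficients, so the words in `j` remain rows in
  -- `C`.
  obtain ⟨π, hπ⟩ := LinearMap.exists_leftInverse_of_injective (shiftSpace φ).subtype
    (Submodule.ker_subtype _)
  have h1 : ∀ i, A i = ∑ j, A i j • (π (Pi.single j 1) : Fin m → ZMod 2) := by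
    intro i
    have h2 : π (A i) = ⟨A i, hAU i⟩ := LinearMap.congr_fun hπ ⟨A i, hAU i⟩
    have h3 : A i = ∑ j, A i j • (Pi.single j 1 : Fin m → ZMod 2) := by
      funext k
      simp [Finset.sum_apply, Pi.single_apply]
    have h4 := congrArg (fun x => ((π x : shiftSpace φ) : Fin m → ZMod 2)) h3
    simp only [h2, map_sum, map_smul] at h4
    refine h4.trans ?_
    simp only [Submodule.coe_sum, Submodule.coe_smul]
  have h2 : ∀ s : Finset (Fin m), ∃ M ∈ tensorStabilizer (psi m C), ∀ i, M i ∈ rowStabilizer φ ∧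
      HasShift (∑ j ∈ s, A i j • (π (Pi.single j 1) : Fin m → ZMod 2)) (M i) := by
    intro s
    induction s using Finset.induction_on with
    | empty => exact ⟨1, one_mem _, fun i => ⟨one_mem _, hasShift_one⟩⟩
    | insert j s hj ih =>
      obtain ⟨M, hM, hMs⟩ := ih
      obtain ⟨Q, hQ, hQs⟩ := (π (Pi.single j 1)).2
      refine ⟨powFamily (fun i => A i j) Q * M,
        mul_mem (powFamily_mem_tensorStabilizer hD (hA j) hQ.1) hM, fun i => ?_⟩
      rw [Pi.mul_apply, powFamily_apply, Finset.sum_insert hj]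
      rcases zmod_two_cases (A i j) with h | h
      · simpa [h] using hMs i
      · rw [h, if_neg one_ne_zero, one_smul]
        exact ⟨mul_mem hQ (hMs i).1, hQs.mul (hMs i).2⟩
  obtain ⟨M, hM, hMs⟩ := h2 Finset.univ
  have h3 : ∏ i, (M i).1 (A i) 0 = 1 := by
    have h4 := congrFun (mem_tensorStabilizer.mp hM) A
    rw [psi_of_mem hA, tact_apply, Finset.sum_eq_single 0, psi_zero, mul_one] at h4
    · exact h4
    · intro A' _ hA'
      by_contra h
      refine hA' (funext fun i => ?_)
      have h5 := (hMs i).2 _ _ (Finset.prod_ne_zero_iff.mp (left_ne_zero_of_mul h) i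
        (Finset.mem_univ i))
      rw [← h1 i] at h5
      exact left_eq_add.mp (h5.trans (add_comm _ _))
    · simp
  have h4 : ∀ i, φ 0 = φ (A i) * (M i).1 (A i) 0 := by
    intro i
    refine rowStabilizer_apply_zero (hMs i).1 ?_
    conv_lhs => rw [h1 i]
    exact (hMs i).2
  calc ∏ i, φ (A i) = ∏ i, (φ (A i) * (M i).1 (A i) 0) := by
        rw [Finset.prod_mul_distrib, h3, mul_one]
    _ = φ 0 ^ N := by
        rw [← Finset.prod_congr rfl fun i _ => h4 i]
        simp

theorem tact_psi_eq_self {C : Submodule (ZMod 2) (Fin N → ZMod 2)} (hC : IsSelfDual C)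
    (hD : IsDoublyEven C) {g : Matrix.unitaryGroup (Fin m → ZMod 2) ℂ}
    (hg : g ∈ cliffordNormalizer m) (hfin : IsOfFinOrder g) :
    tact (fun _ => g.1) (psi m C) = psi m C := by
  classical
  obtain ⟨l, hl⟩ := tact_psi_eq_smul hC hD hg.1
  suffices h : l = 1 by rw [hl, h, one_smul]
  obtain ⟨k, hk, hgk⟩ := isOfFinOrder_iff_pow_eq_one.mp hfin
  have hlk : l ^ k = 1 := by
    have hpow : ∀ n : ℕ, tact (fun _ => ((g ^ n : Matrix.unitaryGroup _ ℂ)).1)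
        (psi m C) = l ^ n • psi m C := by
      intro n
      induction n with
      | zero => rw [pow_zero, pow_zero, one_smul]; exact tact_one _
      | succ n ih =>
        rw [pow_succ, Submonoid.coe_mul, tact_mul, hl, map_smul, ih, smul_smul, pow_succ, mul_comm]
    have h1 := congrFun (hpow k) 0
    rw [hgk, Pi.smul_apply, psi_zero, smul_eq_mul, mul_one] at h1
    rw [← h1]
    exact (congrFun (tact_one _) 0).trans (psi_zero C)
  obtain ⟨w₀, hw₀⟩ : ∃ w₀, g.1 w₀ 0 ≠ 0 := by
    by_contra! hcon
    have h := congrFun (congrFun (Matrix.mem_unitaryGroup_iff'.mp g.2) 0) 0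
    rw [Matrix.mul_apply, Finset.sum_eq_zero fun w _ => by rw [hcon w, mul_zero],
      Matrix.one_apply_eq] at h
    exact zero_ne_one h
  set φ := g.1 w₀ with hφ
  have hU : ∀ v, φ v ≠ 0 ↔ v ∈ shiftSpace φ := by
    refine fun v => ⟨fun hv => exists_rowStabilizer_hasShift hg.1 hw₀ hv, ?_⟩
    rintro ⟨Q, hQ, hs⟩ h0
    have := rowStabilizer_apply_zero hQ hs
    rw [h0, zero_mul] at this
    exact hw₀ this
  have hnorm : ∀ v ∈ shiftSpace φ, ‖φ v‖ = ‖φ 0‖ := by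
    rintro v ⟨Q, hQ, hs⟩
    rw [rowStabilizer_apply_zero hQ hs, norm_mul, norm_of_hasShift hs, mul_one]
  set r := Module.finrank (ZMod 2) (shiftSpace φ) with hr
  have hsum : (2 : ℝ) ^ r * ‖φ 0‖ ^ 2 = 1 := by
    have h := congrFun (congrFun (Matrix.mem_unitaryGroup_iff.mp g.2) w₀) w₀
    rw [Matrix.mul_apply, Matrix.one_apply_eq] at h
    have h2 : ∑ v, ‖φ v‖ ^ 2 = (1 : ℝ) := by
      have h3 : ((∑ v, ‖φ v‖ ^ 2 : ℝ) : ℂ) = 1 := by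
        rw [← h]
        push_cast
        refine Finset.sum_congr rfl fun v _ => ?_
        rw [← Complex.mul_conj']
        rfl
      exact_mod_cast h3
    have h4 : ∀ v, ‖φ v‖ ^ 2 = if v ∈ shiftSpace φ then ‖φ 0‖ ^ 2 else 0 := by
      intro v
      split_ifs with hv
      · rw [hnorm v hv]
      · rw [not_ne_iff.mp fun h => hv ((hU v).mp h), norm_zero]
        norm_num
    rw [Finset.sum_congr rfl fun v _ => h4 v, ← Finset.sum_filter, Finset.sum_const,
      nsmul_eq_mul, ← Fintype.card_subtype] at h2
    have h5 : Fintype.card {v // v ∈ shiftSpace φ} = 2 ^ r := by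
      have := Module.card_eq_pow_finrank (K := ZMod 2) (V := shiftSpace φ)
      rwa [ZMod.card] at this
    rw [h5] at h2
    exact_mod_cast h2
  obtain ⟨n, hn⟩ : ∃ n : ℕ, l = n * φ 0 ^ N := by
    -- The constant array has rows `0` or `1`, which lie in `C`; there `psi` equals 1, and only row
    -- `w₀` of `g` enters.
    have h1 := congrFun hl fun _ => w₀
    rw [Pi.smul_apply, psi_of_mem (A := fun _ => w₀), smul_eq_mul, mul_one, tact_apply] at h1
    · refine ⟨(Finset.univ.filter fun A : Fin N → Fin m → ZMod 2 =>
        (∀ j, (fun i => A i j) ∈ C) ∧ ∀ i, A i ∈ shiftSpace φ).card, ?_⟩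
      rw [← h1, ← nsmul_eq_mul, ← Finset.sum_const, Finset.sum_filter]
      refine Finset.sum_congr rfl fun A _ => ?_
      split_ifs with hA
      · rw [psi_of_mem hA.1, mul_one]
        exact prod_apply_eq_pow hD hA.1 hA.2
      · by_contra h
        refine hA ⟨?_, fun i => ?_⟩
        · by_contra h'
          exact right_ne_zero_of_mul h (if_neg h')
        · exact (hU _).mp (Finset.prod_ne_zero_iff.mp (left_ne_zero_of_mul h) i
            (Finset.mem_univ i))
    · intro j
      have : (fun _ : Fin N => w₀ j) = w₀ j • (1 : Fin N → ZMod 2) := by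
        funext i
        simp
      rw [this]
      exact C.smul_mem _ (one_mem_of_isSelfDual hC hD)
  set z : ℂ := φ 0 * (Real.sqrt 2 : ℂ) ^ r with hz
  have hzn : ‖z‖ = 1 := by
    have h1 : ‖z‖ ^ 2 = 1 := by
      rw [hz, norm_mul, norm_pow, Complex.norm_real, Real.norm_of_nonneg (Real.sqrt_nonneg 2),
        mul_pow, ← pow_mul, mul_comm r 2, pow_mul, Real.sq_sqrt (by norm_num), mul_comm, hsum]
    nlinarith [norm_nonneg z]
  have hlz : l = z ^ N := by
    have hs : (Real.sqrt 2 : ℂ) ^ (r * N) ≠ 0 := pow_ne_zero _ sqrt_two_ne_zero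
    have h1 : l * (Real.sqrt 2 : ℂ) ^ (r * N) = n * z ^ N := by
      rw [hn, hz, mul_pow, ← pow_mul]
      ring
    have h2 : ‖l‖ = 1 := by
      have := congrArg norm hlk
      rw [norm_pow, norm_one] at this
      exact (pow_eq_one_iff_of_nonneg (norm_nonneg l) hk.ne').mp this
    -- Both `l` and `z` have absolute value 1, so comparing norms in `h1` determines `n`.
    have h3 : (Real.sqrt 2 : ℂ) ^ (r * N) = n := by
      have := congrArg norm h1
      rw [norm_mul, h2, one_mul, norm_mul, norm_pow, norm_pow, hzn, one_pow, mul_one,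
        Complex.norm_real, Real.norm_of_nonneg (Real.sqrt_nonneg 2), Complex.norm_natCast] at this
      exact_mod_cast this
    rw [← h3, mul_comm] at h1
    exact mul_left_cancel₀ hs h1
  -- For `N = 0` the exponent `N * k` would be zero and would not show that `z` is a root of unity.
  rcases Nat.eq_zero_or_pos N with hN | hN
  · rw [hlz, hN, pow_zero]
  · have hz8 : z ^ 8 = 1 := by
      refine pow_eight_eq_one_of_mem_cyclo8
        (mul_mem (hg.2 w₀ 0) (pow_mem sqrt_two_mem_cyclo8 r)) (Nat.mul_pos hN hk) ?_
      rw [pow_mul, ← hlz, hlk]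
    obtain ⟨q, hq⟩ := eight_dvd_of_isSelfDual hC hD
    rw [hlz, hq, pow_mul, hz8, one_pow]

theorem toPoly_psi_mem_homogeneousInvariants {C : Submodule (ZMod 2) (Fin N → ZMod 2)}
    (hC : IsSelfDual C) (hD : IsDoublyEven C) :
    toPoly (psi m C) ∈ homogeneousInvariants (complexCliffordGroup m) N := by
  refine ⟨by simpa using toPoly_isHomogeneous (psi m C), fun g hg => ?_⟩
  have h : complexCliffordGroup m ≤ (tensorStabilizer (psi m C)).comap
      (MonoidHom.pi fun _ => MonoidHom.id _) := by
    refine (Subgroup.closure_le _).mpr fun g hg => ?_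
    exact mem_tensorStabilizer.mpr (tact_psi_eq_self hC hD hg.1 hg.2)
  rw [polyAct_toPoly, show tact (fun _ => g.1) (psi m C) = psi m C from h hg]

end Forward

/-! ### Linear algebra -/

/-- From an upper set containing `G` and still spanning `x`, a minimal index `i ∉ G` can be removed:
`T - c i` sends `Ψ i` into the span of larger indices and acts on `x` as `1 - c i ≠ 0`. No linear
independence of `Ψ` is needed. -/
theorem mem_span_of_triangular {ι M : Type*} [Finite ι] [PartialOrder ι] [AddCommGroup M]
    [Module ℂ M] (Ψ : ι → M) (T : M →ₗ[ℂ] M) (c : ι → ℂ) {G : Set ι} (hG : IsUpperSet G)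
    (hT : ∀ i, T (Ψ i) - c i • Ψ i ∈ Submodule.span ℂ (Ψ '' Set.Ioi i))
    (hc : ∀ i ∉ G, c i ≠ 1) {x : M} (hx : x ∈ Submodule.span ℂ (Set.range Ψ)) (hTx : T x = x) :
    x ∈ Submodule.span ℂ (Ψ '' G) := by
  suffices h : ∀ n : ℕ, ∀ U : Set ι, U.ncard = n → IsUpperSet U → G ⊆ U →
      x ∈ Submodule.span ℂ (Ψ '' U) → x ∈ Submodule.span ℂ (Ψ '' G) from
    h _ Set.univ rfl isUpperSet_univ (Set.subset_univ _) (by rwa [Set.image_univ])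
  intro n
  induction n using Nat.strong_induction_on with
  | _ n ih =>
    intro U hn hU hGU hxU
    by_cases hUG : U ⊆ G
    · exact Submodule.span_mono (Set.image_mono hUG) hxU
    obtain ⟨i, ⟨hiU, hiG⟩, hmin⟩ : ∃ i, Minimal (· ∈ U \ G) i :=
      (Set.toFinite (U \ G)).exists_minimal (Set.sdiff_nonempty.mpr hUG)
    have hU' : IsUpperSet (U \ {i}) := by
      rintro a b hab ⟨haU, hai⟩
      refine ⟨hU hab haU, ?_⟩
      rintro rfl
      by_cases haG : a ∈ G
      · exact hiG (hG hab haG)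
      · exact hai (le_antisymm hab (hmin ⟨haU, haG⟩ hab))
    refine ih _ (hn ▸ Set.ncard_sdiff_singleton_lt_of_mem hiU) _ rfl hU'
      (fun j hj => ⟨hGU hj, fun h => hiG (h ▸ hj)⟩) ?_
    have hstable : ∀ y ∈ Submodule.span ℂ (Ψ '' (U \ {i})),
        T y ∈ Submodule.span ℂ (Ψ '' (U \ {i})) := by
      intro y hy
      have : Submodule.span ℂ (Ψ '' (U \ {i})) ≤
          (Submodule.span ℂ (Ψ '' (U \ {i}))).comap T := by
        refine Submodule.span_le.mpr ?_
        rintro _ ⟨j, hj, rfl⟩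
        have h1 : T (Ψ j) = (T (Ψ j) - c j • Ψ j) + c j • Ψ j := by abel
        change T (Ψ j) ∈ Submodule.span ℂ (Ψ '' (U \ {i}))
        rw [h1]
        refine add_mem (Submodule.span_mono (Set.image_mono fun k hk => ?_) (hT j))
          (Submodule.smul_mem _ _ (Submodule.subset_span ⟨j, hj, rfl⟩))
        exact hU' (le_of_lt hk) hj
      exact this hy
    have hxU2 : x ∈ Submodule.span ℂ (insert (Ψ i) (Ψ '' (U \ {i}))) := by
      rwa [← Set.image_insert_eq, Set.insert_sdiff_singleton, Set.insert_eq_of_mem hiU]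
    obtain ⟨a, y, hy, hxy⟩ := Submodule.mem_span_insert.mp hxU2
    have h1 : (1 - c i) • x = a • (T (Ψ i) - c i • Ψ i) + (T y - c i • y) := by
      calc (1 - c i) • x = T x - c i • x := by rw [hTx, sub_smul, one_smul]
        _ = _ := by
          rw [hxy, map_add, map_smul]
          module
    have h2 : (1 - c i) • x ∈ Submodule.span ℂ (Ψ '' (U \ {i})) := by
      rw [h1]
      refine add_mem (Submodule.smul_mem _ _
        (Submodule.span_mono (Set.image_mono fun k hk => ?_) (hT i)))
        (sub_mem (hstable y hy) (Submodule.smul_mem _ _ hy))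
      exact ⟨hU (le_of_lt hk) hiU, fun h => (ne_of_gt hk) h⟩
    exact (Submodule.smul_mem_iff _ (sub_ne_zero.mpr (hc i hiG).symm)).mp h2

/-- Both maps split `V` as kernel plus a copy of the common range, and the kernels have equal
dimension; `e` glues an isomorphism of kernels to the identity of the range. -/
theorem exists_equiv_comp_eq_of_range_eq {K V Q : Type*} [Field K] [AddCommGroup V] [Module K V]
    [FiniteDimensional K V] [AddCommGroup Q] [Module K Q] (f g : V →ₗ[K] Q)
    (h : LinearMap.range f = LinearMap.range g) : ∃ e : V ≃ₗ[K] V, ∀ v, f (e v) = g v := by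
  obtain ⟨s, hs⟩ : ∃ s : LinearMap.range f →ₗ[K] V, ∀ y, f (s y) = y := by
    obtain ⟨s, hs⟩ := f.rangeRestrict.exists_rightInverse_of_surjective f.range_rangeRestrict
    exact ⟨s, fun y => congrArg Subtype.val (LinearMap.congr_fun hs y)⟩
  obtain ⟨t, ht⟩ : ∃ t : LinearMap.range g →ₗ[K] V, ∀ y, g (t y) = y := by
    obtain ⟨t, ht⟩ := g.rangeRestrict.exists_rightInverse_of_surjective g.range_rangeRestrict
    exact ⟨t, fun y => congrArg Subtype.val (LinearMap.congr_fun ht y)⟩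
  have hrank : Module.finrank K (LinearMap.ker g) = Module.finrank K (LinearMap.ker f) := by
    have h1 := f.finrank_range_add_finrank_ker
    have h2 := g.finrank_range_add_finrank_ker
    rw [h] at h1
    omega
  let κ : LinearMap.ker g ≃ₗ[K] LinearMap.ker f := LinearEquiv.ofFinrankEq _ _ hrank
  let p : V →ₗ[K] LinearMap.ker g :=
    (LinearMap.id - t ∘ₗ g.rangeRestrict).codRestrict _ fun v => by
      simp [LinearMap.mem_ker, ht]
  let gr : V →ₗ[K] LinearMap.range f := g.codRestrict _ fun v => h ▸ LinearMap.mem_range_self g v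
  let e : V →ₗ[K] V := s ∘ₗ gr + (LinearMap.ker f).subtype ∘ₗ κ.toLinearMap ∘ₗ p
  have he : ∀ v, f (e v) = g v := by
    intro v
    have h1 : f (κ (p v)) = 0 := (κ (p v)).2
    simp only [e, LinearMap.add_apply, LinearMap.comp_apply, map_add, hs, Submodule.subtype_apply,
      LinearEquiv.coe_coe, h1, add_zero]
    rfl
  have hinj : Function.Injective e := by
    rw [injective_iff_map_eq_zero]
    intro v hv
    have h1 : g v = 0 := by rw [← he v, hv, map_zero]
    have h2 : gr v = 0 := Subtype.ext h1
    have h3 : (p v : V) = v := by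
      have : g.rangeRestrict v = 0 := Subtype.ext h1
      simp [p, this]
    have h4 : ((κ (p v) : LinearMap.ker f) : V) = 0 := by
      have : e v = s (gr v) + κ (p v) := rfl
      rw [hv, h2, map_zero, zero_add] at this
      exact this.symm
    have h5 : p v = 0 := κ.map_eq_zero_iff.mp (Subtype.ext h4)
    rw [← h3, h5]
    rfl
  exact ⟨LinearEquiv.ofInjectiveEndo e hinj, he⟩

/-! ### Monomial symmetries of invariant polynomials -/

section Monomial

theorem coeff_polyAct_diagonal {n : Type*} [Fintype n] [DecidableEq n] (d : n → ℂ)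
    (p : MvPolynomial n ℂ) (s : n →₀ ℕ) :
    (polyAct (Matrix.diagonal d) p).coeff s = (s.prod fun v k => d v ^ k) * p.coeff s := by
  have h : ∀ w, ∑ v, MvPolynomial.C (Matrix.diagonal d v w) * MvPolynomial.X v =
      MvPolynomial.C (d w) * (MvPolynomial.X w : MvPolynomial n ℂ) := by
    intro w
    rw [Finset.sum_eq_single w]
    · rw [Matrix.diagonal_apply_eq]
    · intro v _ hv
      rw [Matrix.diagonal_apply_ne _ hv, map_zero, zero_mul]
    · simp
  induction p using MvPolynomial.induction_on' with
  | monomial t a =>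
    have h1 : polyAct (Matrix.diagonal d) (MvPolynomial.monomial t a) =
        MvPolynomial.monomial t (a * t.prod fun v k => d v ^ k) := by
      rw [polyAct, MvPolynomial.aeval_monomial, Finsupp.prod]
      simp only [h, mul_pow, Finset.prod_mul_distrib, MvPolynomial.algebraMap_eq]
      rw [MvPolynomial.monomial_eq, map_mul, Finsupp.prod, Finsupp.prod, map_prod]
      simp only [map_pow, mul_assoc]
    rw [h1, MvPolynomial.coeff_monomial, MvPolynomial.coeff_monomial]
    split_ifs with hs
    · rw [hs, mul_comm]
    · rw [mul_zero]
  | add p q hp hq => rw [map_add, MvPolynomial.coeff_add, hp, hq, MvPolynomial.coeff_add, mul_add]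

theorem mono_prod {n ι : Type*} [Fintype ι] (A : ι → n) (d : n → ℂ) :
    ((mono A).prod fun v k => d v ^ k) = ∏ i, d (A i) := by
  rw [mono, ← Finsupp.prod_finsetSum_index (fun _ => pow_zero _) fun _ _ _ => pow_add _ _ _]
  simp

theorem polyAct_permU {n : Type*} [Fintype n] [DecidableEq n] (π : Equiv.Perm n)
    (p : MvPolynomial n ℂ) : polyAct (permU π).1 p = MvPolynomial.rename π p := by
  have h : ∀ w, ∑ v, MvPolynomial.C ((permU π).1 v w) * MvPolynomial.X v =
      (MvPolynomial.X (π w) : MvPolynomial n ℂ) := by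
    intro w
    simp [permU_apply]
  have h2 : polyAct (permU π).1 = MvPolynomial.rename π := by
    refine MvPolynomial.algHom_ext fun w => ?_
    rw [polyAct, MvPolynomial.aeval_X, h, MvPolynomial.rename_X]
  rw [h2]

theorem mono_comp {n ι : Type*} [Fintype ι] (π : Equiv.Perm n) (A : ι → n) :
    mono (fun i => π (A i)) = (mono A).mapDomain π := by
  rw [mono, mono, Finsupp.mapDomain_finsetSum]
  simp [Finsupp.mapDomain_single]

theorem symLift_comp {n ι : Type*} [Fintype n] [DecidableEq n] [Fintype ι] [DecidableEq ι]
    (π : Equiv.Perm n) {p : MvPolynomial n ℂ} (hp : polyAct (permU π).1 p = p) (A : ι → n) :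
    symLift p (fun i => π (A i)) = symLift p A := by
  have h1 : p.coeff (mono fun i => π (A i)) = p.coeff (mono A) := by
    conv_lhs => rw [← hp]
    rw [polyAct_permU, mono_comp, MvPolynomial.coeff_rename_mapDomain _ π.injective]
  rw [symLift, symLift, h1]
  congr 3
  refine (Finset.card_equiv (Equiv.piCongrRight fun _ => π) fun B => ?_).symm
  simp only [Finset.mem_filter, Finset.mem_univ, true_and]
  change _ ↔ mono (fun i => π (B i)) = _
  rw [mono_comp, mono_comp]
  exact (Finsupp.mapDomain_injective π.injective).eq_iff.symm

variable {m N : ℕ}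

theorem gateU_signU_coe (χ : Module.Dual (ZMod 2) (Fin m → ZMod 2)) :
    (gateU (signU χ) (signU_mul_self χ)).1 =
      Matrix.diagonal fun v => zeta8 * if χ v = 0 then 1 else -Complex.I := by
  have hz : zeta8 = (Real.sqrt 2 : ℂ)⁻¹ * (1 + Complex.I) := by
    rw [← sqrt_two_mul_zeta8, inv_mul_cancel_left₀ sqrt_two_ne_zero]
  rw [gateU_coe, signU_coe, ← Matrix.diagonal_one, ← Matrix.diagonal_smul, Matrix.diagonal_add,
    ← Matrix.diagonal_smul]
  congr 1
  funext v
  simp only [Pi.smul_apply, smul_eq_mul, sgn, hz]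
  split_ifs
  · ring
  · linear_combination (Real.sqrt 2 : ℂ)⁻¹ * Complex.I_sq

/-- The monomials whose exponents satisfy all divisibility conditions imposed by the diagonal
gates. -/
def IsAdmissible (s : (Fin m → ZMod 2) →₀ ℕ) : Prop :=
  ∀ χ : Module.Dual (ZMod 2) (Fin m → ZMod 2),
    (s.prod fun v k => (if χ v = 0 then 1 else Complex.I) ^ k) = 1

theorem isAdmissible_mono_iff (A : Fin N → Fin m → ZMod 2) :
    IsAdmissible (mono A) ↔
      ∀ χ : Module.Dual (ZMod 2) (Fin m → ZMod 2), 4 ∣ hammingNorm fun i => χ (A i) := by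
  refine forall_congr' fun χ => ?_
  rw [mono_prod A fun v => if χ v = 0 then 1 else Complex.I,
    ← I_pow_hammingNorm fun i => χ (A i), I_pow_eq_one_iff]

/-- The diagonal gate of `χ` has entries `ζ₈` and `-i ζ₈`, so it scales the monomial of `A` by `ζ₈^N
(-i)^k`, with `k` the weight of `χ` applied to the columns. The case `χ = 0` gives `ζ₈^N = 1`, and
then all these weights are divisible by 4. -/
theorem eight_dvd_and_isAdmissible_of_coeff_ne_zero {p : MvPolynomial (Fin m → ZMod 2) ℂ}
    (hp : p ∈ homogeneousInvariants (complexCliffordGroup m) N) {s : (Fin m → ZMod 2) →₀ ℕ}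
    (hs : p.coeff s ≠ 0) : 8 ∣ N ∧ IsAdmissible s := by
  obtain ⟨A, rfl⟩ : ∃ A : Fin N → Fin m → ZMod 2, mono A = s :=
    exists_mono s (by_contra fun h => hs (hp.1.coeff_eq_zero h))
  have h1 : ∀ χ : Module.Dual (ZMod 2) (Fin m → ZMod 2),
      zeta8 ^ N * ∏ i, (if χ (A i) = 0 then 1 else -Complex.I) = 1 := by
    intro χ
    have h := congrArg (MvPolynomial.coeff (mono A)) (hp.2 _ (gateU_signU_mem χ))
    rw [gateU_signU_coe, coeff_polyAct_diagonal,
      mono_prod A fun v => zeta8 * if χ v = 0 then 1 else -Complex.I, Finset.prod_mul_distrib] at h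
    simp only [Finset.prod_const, Finset.card_univ, Fintype.card_fin] at h
    exact mul_right_cancel₀ hs (h.trans (one_mul _).symm)
  have h8 : zeta8 ^ N = 1 := by simpa using h1 0
  refine ⟨(zeta8_isPrimitiveRoot.pow_eq_one_iff_dvd N).mp h8, fun χ => ?_⟩
  rw [mono_prod A fun v => if χ v = 0 then 1 else Complex.I, ← inv_eq_one, ← Finset.prod_inv_distrib]
  have h := h1 χ
  rw [h8, one_mul] at h
  refine (Finset.prod_congr rfl fun i _ => ?_).trans h
  split_ifs
  · exact inv_one
  · exact Complex.inv_I

open Classical in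
/-- The projection onto the span of the admissible monomials. -/
def admissibleProj (m : ℕ) :
    MvPolynomial (Fin m → ZMod 2) ℂ →ₗ[ℂ] MvPolynomial (Fin m → ZMod 2) ℂ :=
  (MvPolynomial.basisMonomials (Fin m → ZMod 2) ℂ).constr ℂ fun s =>
    if IsAdmissible s then MvPolynomial.monomial s 1 else 0

open Classical in
theorem admissibleProj_monomial (s : (Fin m → ZMod 2) →₀ ℕ) (a : ℂ) :
    admissibleProj m (MvPolynomial.monomial s a) =
      MvPolynomial.monomial s (if IsAdmissible s then a else 0) := by
  have h1 : MvPolynomial.monomial s a =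
      a • (MvPolynomial.basisMonomials (Fin m → ZMod 2) ℂ) s := by
    rw [MvPolynomial.coe_basisMonomials, MvPolynomial.smul_monomial, smul_eq_mul, mul_one]
  rw [h1, map_smul, admissibleProj, Module.Basis.constr_basis]
  split_ifs
  · rw [MvPolynomial.smul_monomial, smul_eq_mul, mul_one]
  · rw [smul_zero, map_zero]

theorem admissibleProj_eq_self {p : MvPolynomial (Fin m → ZMod 2) ℂ}
    (hp : ∀ s, p.coeff s ≠ 0 → IsAdmissible s) : admissibleProj m p = p := by
  classical
  conv_lhs => rw [← p.support_sum_monomial_coeff]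
  conv_rhs => rw [← p.support_sum_monomial_coeff]
  rw [map_sum]
  refine Finset.sum_congr rfl fun s hs => ?_
  rw [admissibleProj_monomial, if_pos (hp s (MvPolynomial.mem_support_iff.mp hs))]

open Classical in
theorem admissibleProj_toPoly (f : (Fin N → Fin m → ZMod 2) → ℂ) :
    admissibleProj m (toPoly f) = toPoly fun A => if IsAdmissible (mono A) then f A else 0 := by
  rw [toPoly_apply, toPoly_apply, map_sum]
  exact Finset.sum_congr rfl fun A _ => admissibleProj_monomial _ _

end Monomial

/-! ### Invariants are spanned by enumerators of doubly-even codes -/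

section Reverse

variable {m N : ℕ}

/-- The doubly-even codes of length `N` that contain the all-one word. -/
abbrev EvenCode (N : ℕ) : Type :=
  {D : Submodule (ZMod 2) (Fin N → ZMod 2) // IsDoublyEven D ∧ (1 : Fin N → ZMod 2) ∈ D}

instance finite_submodule : Finite (Submodule (ZMod 2) (Fin N → ZMod 2)) :=
  Finite.of_injective (fun D => (D : Set (Fin N → ZMod 2))) SetLike.coe_injective

/-! ### Codes generated by the rows of an array -/

/-- The map that sends `b` to the linear combination of the rows of `A` with coefficients `b`. -/
def rowMap (A : Fin N → Fin m → ZMod 2) : (Fin m → ZMod 2) →ₗ[ZMod 2] (Fin N → ZMod 2) where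
  toFun b i := b ⬝ᵥ A i
  map_add' b b' := by funext i; simp [add_dotProduct]
  map_smul' a b := by funext i; simp [smul_dotProduct]

theorem rowMap_apply (A : Fin N → Fin m → ZMod 2) (b : Fin m → ZMod 2) (i : Fin N) :
    rowMap A b i = b ⬝ᵥ A i := rfl

/-- The code generated by the rows of `A` and the all-one word. -/
def rowCode (A : Fin N → Fin m → ZMod 2) : Submodule (ZMod 2) (Fin N → ZMod 2) :=
  LinearMap.range (rowMap A) ⊔ Submodule.span (ZMod 2) {1}

theorem one_mem_rowCode (A : Fin N → Fin m → ZMod 2) : (1 : Fin N → ZMod 2) ∈ rowCode A :=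
  (le_sup_right : _ ≤ rowCode A) (Submodule.mem_span_singleton_self _)

theorem rowMap_single (A : Fin N → Fin m → ZMod 2) (j : Fin m) :
    rowMap A (Pi.single j 1) = fun i => A i j := by
  funext i
  rw [rowMap_apply, single_dotProduct, one_mul]

theorem rowCode_le_iff {D : Submodule (ZMod 2) (Fin N → ZMod 2)} (hD : (1 : Fin N → ZMod 2) ∈ D)
    (A : Fin N → Fin m → ZMod 2) : rowCode A ≤ D ↔ ∀ j, (fun i => A i j) ∈ D := by
  constructor
  · intro h j
    rw [← rowMap_single]
    exact h ((le_sup_left : _ ≤ rowCode A) (LinearMap.mem_range_self _ _))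
  · intro h
    refine sup_le ?_ ((Submodule.span_singleton_le_iff_mem _ _).mpr hD)
    rintro _ ⟨b, rfl⟩
    have := dual_comp_mem h (dotDual b)
    simp only [dotDual_apply] at this
    exact this

/-- Admissibility covers the combinations of rows; adding the all-one word replaces a weight `k` by
`N - k`. -/
theorem isDoublyEven_rowCode (hN : 8 ∣ N) {A : Fin N → Fin m → ZMod 2}
    (hA : IsAdmissible (mono A)) : IsDoublyEven (rowCode A) := by
  intro c hc
  obtain ⟨_, ⟨b, rfl⟩, y, hy, rfl⟩ := Submodule.mem_sup.mp hc
  obtain ⟨ε, rfl⟩ := Submodule.mem_span_singleton.mp hy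
  have h1 : 4 ∣ hammingNorm (rowMap A b) := by
    have := (isAdmissible_mono_iff A).mp hA (dotDual b)
    simp only [dotDual_apply] at this
    exact this
  rcases zmod_two_cases ε with rfl | rfl
  · simpa using h1
  · rw [one_smul]
    have h2 : hammingNorm (rowMap A b) + hammingNorm (rowMap A b + 1) = N := by
      rw [hammingNorm, hammingNorm]
      have h3 : ∀ i, (rowMap A b + 1) i ≠ 0 ↔ ¬ rowMap A b i ≠ 0 := by
        intro i
        rw [Pi.add_apply, Pi.one_apply]
        rcases zmod_two_cases (rowMap A b i) with h | h <;>
          simp [h, show (1 + 1 : ZMod 2) = 0 from rfl]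
      rw [Finset.filter_congr fun i _ => h3 i, Finset.card_filter_add_card_filter_not]
      simp
    have h4 : 4 ∣ N := dvd_trans (by norm_num) hN
    rw [← h2] at h4
    exact (Nat.dvd_add_right h1).mp h4

/-- Modulo the all-one word the two row maps have the same range, hence differ by an automorphism
`e`. On columns `e` acts by its transpose `L`, and the multiples of the all-one word assemble to the
translation `a`. -/
theorem exists_affine_of_rowCode_eq {A B : Fin N → Fin m → ZMod 2} (h : rowCode A = rowCode B) :
    ∃ (π : Equiv.Perm (Fin m → ZMod 2)) (L : (Fin m → ZMod 2) →ₗ[ZMod 2] (Fin m → ZMod 2))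
      (a : Fin m → ZMod 2), (∀ v, π v = L v + a) ∧ B = fun i => π (A i) := by
  set q := (Submodule.span (ZMod 2) {(1 : Fin N → ZMod 2)}).mkQ with hq
  have hr : ∀ A : Fin N → Fin m → ZMod 2,
      LinearMap.range (q ∘ₗ rowMap A) = (rowCode A).map q := by
    intro A
    rw [rowCode, Submodule.map_sup, LinearMap.range_comp, Submodule.mkQ_map_self, sup_bot_eq]
  obtain ⟨e, he⟩ := exists_equiv_comp_eq_of_range_eq (q ∘ₗ rowMap A) (q ∘ₗ rowMap B)
    (by rw [hr, hr, h])
  have h1 : ∀ j, ∃ a : ZMod 2, ∀ i, B i j = e (Pi.single j 1) ⬝ᵥ A i + a := by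
    intro j
    have h2 := he (Pi.single j 1)
    rw [LinearMap.comp_apply, LinearMap.comp_apply, hq, Submodule.mkQ_apply, Submodule.mkQ_apply,
      eq_comm, Submodule.Quotient.eq, rowMap_single] at h2
    obtain ⟨a, ha⟩ := Submodule.mem_span_singleton.mp h2
    refine ⟨a, fun i => ?_⟩
    have h3 := congrFun ha i
    simp only [Pi.smul_apply, Pi.one_apply, smul_eq_mul, mul_one, Pi.sub_apply, rowMap_apply] at h3
    rw [h3]
    ring
  choose a ha using h1
  let L : (Fin m → ZMod 2) →ₗ[ZMod 2] (Fin m → ZMod 2) :=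
    { toFun := fun v j => e (Pi.single j 1) ⬝ᵥ v
      map_add' := fun v w => by funext j; simp [dotProduct_add]
      map_smul' := fun c v => by funext j; simp [dotProduct_smul] }
  have hL : Function.Injective L := by
    rw [injective_iff_map_eq_zero]
    intro v hv
    have h2 : ∀ b, e b ⬝ᵥ v = 0 := by
      intro b
      have h3 : b = ∑ j, b j • (Pi.single j 1 : Fin m → ZMod 2) := by
        funext k
        simp [Finset.sum_apply, Pi.single_apply]
      rw [h3, map_sum, sum_dotProduct]
      refine Finset.sum_eq_zero fun j _ => ?_
      rw [map_smul, smul_dotProduct, show e (Pi.single j 1) ⬝ᵥ v = 0 from congrFun hv j, smul_zero]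
    funext j
    have h4 := h2 (e.symm (Pi.single j 1))
    rwa [LinearEquiv.apply_symm_apply, single_dotProduct, one_mul] at h4
  refine ⟨(LinearEquiv.ofInjectiveEndo L hL).toEquiv.trans (Equiv.addRight a), L, a,
    fun v => rfl, ?_⟩
  funext i j
  exact ha j i

-- Möbius inversion by induction on inclusion: `psi m D` is the sum of the indicators of `rowCode A
-- = D'` over all `D' ≤ D`.
open Classical in
theorem toPoly_rowCode_indicator_mem (D : EvenCode N) :
    toPoly (fun A : Fin N → Fin m → ZMod 2 => if rowCode A = D.1 then (1 : ℂ) else 0) ∈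
      Submodule.span ℂ (Set.range fun D : EvenCode N => toPoly (psi m D.1)) := by
  have := Fintype.ofFinite (EvenCode N)
  induction D using WellFoundedLT.induction with
  | _ D ih =>
    have h : (fun A : Fin N → Fin m → ZMod 2 => if rowCode A = D.1 then (1 : ℂ) else 0) =
        psi m D.1 - ∑ D' : EvenCode N with D' < D,
          fun A : Fin N → Fin m → ZMod 2 => if rowCode A = D'.1 then (1 : ℂ) else 0 := by
      funext A
      rw [Pi.sub_apply, Finset.sum_apply, eq_sub_iff_add_eq]
      by_cases hA : rowCode A ≤ D.1
      · have hev : IsDoublyEven (rowCode A) := fun c hc => D.2.1 c (hA hc)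
        rw [psi_of_mem ((rowCode_le_iff D.2.2 A).mp hA)]
        by_cases hAD : rowCode A = D.1
        · rw [if_pos hAD, Finset.sum_eq_zero, add_zero]
          intro D' hD'
          rw [if_neg]
          intro h'
          exact (Finset.mem_filter.mp hD').2.ne (Subtype.ext (h'.symm.trans hAD))
        · rw [if_neg hAD, zero_add,
            Finset.sum_eq_single (⟨rowCode A, hev, one_mem_rowCode A⟩ : EvenCode N)]
          · rw [if_pos rfl]
          · intro D' _ hne
            exact if_neg fun h' => hne (Subtype.ext h'.symm)
          · intro hnot
            refine absurd (Finset.mem_filter.mpr ⟨Finset.mem_univ _, ?_⟩) hnot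
            exact lt_of_le_of_ne hA fun h' => hAD (congrArg Subtype.val h')
      · rw [if_neg fun h' => hA h'.le, Finset.sum_eq_zero, add_zero, psi, if_neg]
        · exact fun h' => hA ((rowCode_le_iff D.2.2 A).mpr h')
        · intro D' hD'
          rw [if_neg]
          intro h'
          exact hA (h'.le.trans (Finset.mem_filter.mp hD').2.le)
    rw [h, map_sub, map_sum]
    refine sub_mem (Submodule.subset_span ⟨D, rfl⟩) (sum_mem fun D' hD' => ?_)
    exact ih D' (Finset.mem_filter.mp hD').2

theorem mem_span_psi_of_invariant {p : MvPolynomial (Fin m → ZMod 2) ℂ}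
    (hp : p ∈ homogeneousInvariants (complexCliffordGroup m) N) :
    p ∈ Submodule.span ℂ (Set.range fun D : EvenCode N => toPoly (psi m D.1)) := by
  classical
  have := Fintype.ofFinite (EvenCode N)
  set f : (Fin N → Fin m → ZMod 2) → ℂ := symLift p with hf
  have hcode : ∀ A, f A ≠ 0 → IsDoublyEven (rowCode A) := by
    intro A hA
    have := eight_dvd_and_isAdmissible_of_coeff_ne_zero hp (right_ne_zero_of_mul hA)
    exact isDoublyEven_rowCode this.1 this.2
  have hinv : ∀ A B, rowCode A = rowCode B → f A = f B := by
    intro A B h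
    obtain ⟨π, L, a, hπ, rfl⟩ := exists_affine_of_rowCode_eq h
    exact (symLift_comp π (hp.2 _ (permU_mem_of_affine π L a hπ)) A).symm
  let c : EvenCode N → ℂ := fun D => if h : ∃ A, rowCode A = D.1 then f h.choose else 0
  have hsum : f = ∑ D : EvenCode N, c D •
      fun A : Fin N → Fin m → ZMod 2 => if rowCode A = D.1 then (1 : ℂ) else 0 := by
    funext A
    rw [Finset.sum_apply]
    simp only [Pi.smul_apply, smul_eq_mul, mul_ite, mul_one, mul_zero]
    by_cases hA : f A = 0
    · rw [hA, Finset.sum_eq_zero]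
      intro D _
      split_ifs with h
      · have hex : ∃ A : Fin N → Fin m → ZMod 2, rowCode A = D.1 := ⟨A, h⟩
        rw [show c D = f hex.choose from dif_pos hex, ← hA]
        exact hinv _ _ (hex.choose_spec.trans h.symm)
      · rfl
    · rw [Finset.sum_eq_single (⟨rowCode A, hcode A hA, one_mem_rowCode A⟩ : EvenCode N)]
      · have hex : ∃ A' : Fin N → Fin m → ZMod 2, rowCode A' = rowCode A := ⟨A, rfl⟩
        rw [if_pos rfl]
        refine Eq.trans ?_ (dif_pos hex).symm
        exact (hinv _ _ hex.choose_spec).symm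
      · intro D _ hne
        exact if_neg fun h' => hne (Subtype.ext h'.symm)
      · intro h
        exact absurd (Finset.mem_univ _) h
  rw [← toPoly_symLift hp.1, ← hf, hsum, map_sum]
  refine sum_mem fun D _ => ?_
  rw [map_smul]
  exact Submodule.smul_mem _ _ (toPoly_rowCode_indicator_mem D)

/-! ### The action of the non-diagonal gates -/

theorem tact_gateU_shiftU (u : Fin m → ZMod 2) (f : (Fin N → Fin m → ZMod 2) → ℂ)
    (A : Fin N → Fin m → ZMod 2) :
    tact (fun _ => (gateU (shiftU u) (shiftU_mul_self u)).1) f A =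
      (Real.sqrt 2 : ℂ)⁻¹ ^ N *
        ∑ w : Fin N → ZMod 2, Complex.I ^ hammingNorm w * f (A + fun i => w i • u) := by
  have h1 : ∀ B : Fin N → Fin m → ZMod 2,
      ∏ i, (gateU (shiftU u) (shiftU_mul_self u)).1 (A i) (B i) =
        (Real.sqrt 2 : ℂ)⁻¹ ^ N * ∑ w : Fin N → ZMod 2,
          Complex.I ^ hammingNorm w * if B = A + (fun i => w i • u) then 1 else 0 := by
    intro B
    have h2 : ∀ i, (gateU (shiftU u) (shiftU_mul_self u)).1 (A i) (B i) =
        (Real.sqrt 2 : ℂ)⁻¹ * ∑ x : ZMod 2, (if x = 0 then 1 else Complex.I) *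
          if B i = A i + x • u then 1 else 0 := by
      intro i
      have h3 : A i = B i + u ↔ B i = A i + u := by
        rw [← sub_eq_iff_eq_add, ZModModule.sub_eq_add, eq_comm]
      rw [gateU_coe, Matrix.smul_apply, Matrix.add_apply, Matrix.smul_apply, shiftU_apply,
        show (Finset.univ : Finset (ZMod 2)) = {0, 1} from rfl]
      simp [Matrix.one_apply, h3, eq_comm]
    rw [Finset.prod_congr rfl fun i _ => h2 i, Finset.prod_mul_distrib,
      ← sum_prod_eq_prod_sum (fun i x => (if x = 0 then 1 else Complex.I) *
          if B i = A i + x • u then (1 : ℂ) else 0)]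
    simp only [Finset.prod_const, Finset.card_univ, Fintype.card_fin]
    congr 1
    refine Finset.sum_congr rfl fun w _ => ?_
    rw [Finset.prod_mul_distrib, ← I_pow_hammingNorm, Finset.prod_ite_zero]
    simp [funext_iff]
  rw [tact_apply]
  simp only [h1, Finset.mul_sum, Finset.sum_mul]
  rw [Finset.sum_comm]
  refine Finset.sum_congr rfl fun w _ => ?_
  rw [Finset.sum_eq_single (A + fun i => w i • u)]
  · rw [if_pos rfl]; ring
  · intro B _ hB
    rw [if_neg hB]; ring
  · simp

open Classical in
/-- The words of weight divisible by `4` in the dual code. -/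
def extensionWords (D : Submodule (ZMod 2) (Fin N → ZMod 2)) : Finset (Fin N → ZMod 2) :=
  Finset.univ.filter fun w => (∀ c ∈ D, w ⬝ᵥ c = 0) ∧ 4 ∣ hammingNorm w

theorem mem_extensionWords {D : Submodule (ZMod 2) (Fin N → ZMod 2)} {w : Fin N → ZMod 2} :
    w ∈ extensionWords D ↔ (∀ c ∈ D, w ⬝ᵥ c = 0) ∧ 4 ∣ hammingNorm w := by
  simp [extensionWords]

theorem mem_extensionWords_of_mem {D : Submodule (ZMod 2) (Fin N → ZMod 2)} (hD : IsDoublyEven D)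
    {w : Fin N → ZMod 2} (hw : w ∈ D) : w ∈ extensionWords D :=
  mem_extensionWords.mpr ⟨fun _ hc => hD.dotProduct_eq_zero hw hc, hD w hw⟩

theorem psi_ne_zero_iff {D : Submodule (ZMod 2) (Fin N → ZMod 2)} {A : Fin N → Fin m → ZMod 2} :
    psi m D A ≠ 0 ↔ ∀ j, (fun i => A i j) ∈ D := by
  classical
  rw [psi]
  split_ifs with h <;> simp [h]

-- The summand is invariant under `D`, so only `w ∈ D^⊥` counts. If adding `w ⊗ u` to `A` gives rows
-- in `D`, a coordinate with `u j = 1` shows that `w` and row `j` of `A` have equal weight modulo 4.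
-- So admissibility of `A` forces `4 ∣ |w|`; conversely, a nonzero term with `w ∈ extensionWords D`
-- makes `A` admissible.
open Classical in
theorem admissible_tact_gateU_psi {D : Submodule (ZMod 2) (Fin N → ZMod 2)} (hD : IsDoublyEven D)
    {u : Fin m → ZMod 2} (hu : u ≠ 0) (A : Fin N → Fin m → ZMod 2) :
    (if IsAdmissible (mono A) then
      tact (fun _ => (gateU (shiftU u) (shiftU_mul_self u)).1) (psi m D) A else 0) =
      (Real.sqrt 2 : ℂ)⁻¹ ^ N * ∑ w ∈ extensionWords D, psi m D (A + fun i => w i • u) := by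
  split_ifs with hA
  · rw [tact_gateU_shiftU, sum_I_pow_mul D hD (fun w => psi m D (A + fun i => w i • u))]
    · congr 1
      have hsub : extensionWords D ⊆ Finset.univ.filter fun w : Fin N → ZMod 2 =>
          ∀ c ∈ D, w ⬝ᵥ c = 0 := fun w hw =>
        Finset.mem_filter.mpr ⟨Finset.mem_univ _, (mem_extensionWords.mp hw).1⟩
      rw [← Finset.sum_subset hsub]
      · refine Finset.sum_congr rfl fun w hw => ?_
        rw [I_pow_eq_one_iff.mpr (mem_extensionWords.mp hw).2, one_mul]
      · intro w hw hwE
        by_contra h0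
        refine hwE (mem_extensionWords.mpr ⟨(Finset.mem_filter.mp hw).2, ?_⟩)
        obtain ⟨j, hj⟩ := Function.ne_iff.mp hu
        have huj : u j = 1 := (zmod_two_cases (u j)).resolve_left hj
        have hc := psi_ne_zero_iff.mp (right_ne_zero_of_mul h0) j
        have hc2 : (fun i => (A + fun i => w i • u : Fin N → Fin m → ZMod 2) i j) =
            (fun i => A i j) + w := by
          funext i
          simp [huj]
        rw [hc2] at hc
        have h4 := I_pow_hammingNorm_add w ((fun i => A i j) + w)
        rw [I_pow_of_mem hD hc, (Finset.mem_filter.mp hw).2 _ hc, sgn_zero, mul_one, mul_one,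
          add_left_comm, ZModModule.add_self, add_zero] at h4
        rw [← I_pow_eq_one_iff, ← h4, I_pow_eq_one_iff]
        exact (isAdmissible_mono_iff A).mp hA (LinearMap.proj j)
    · intro w c hc
      have : (A + fun i => (w + c) i • u) = (A + fun i => w i • u) + fun i => c i • u := by
        funext i
        simp [add_smul, add_assoc]
      rw [this, psi_add_smul hc]
  · rw [Finset.sum_eq_zero, mul_zero]
    intro w hw
    by_contra h0
    refine hA ((isAdmissible_mono_iff A).mpr fun χ => ?_)
    have h1 := dual_comp_mem (psi_ne_zero_iff.mp h0) χ
    have h2 : (fun i => χ (A i)) = χ u • w +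
        fun i => χ ((A + fun i => w i • u : Fin N → Fin m → ZMod 2) i) := by
      funext i
      simp only [Pi.add_apply, Pi.smul_apply, map_add, map_smul, smul_eq_mul]
      rw [mul_comm (w i), add_left_comm, ZModModule.add_self, add_zero]
    rw [h2]
    rcases zmod_two_cases (χ u) with h | h
    · rw [h, zero_smul, zero_add]
      exact hD _ h1
    · rw [h, one_smul, ← I_pow_eq_one_iff, I_pow_hammingNorm_add, I_pow_of_mem hD h1,
        I_pow_eq_one_iff.mpr (mem_extensionWords.mp hw).2, (mem_extensionWords.mp hw).1 _ h1]
      simp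

theorem mem_sup_span_singleton_iff {D : Submodule (ZMod 2) (Fin N → ZMod 2)}
    {w x : Fin N → ZMod 2} :
    x ∈ D ⊔ Submodule.span (ZMod 2) {w} ↔ ∃ a : ZMod 2, x + a • w ∈ D := by
  rw [Submodule.mem_sup]
  constructor
  · rintro ⟨y, hy, z, hz, rfl⟩
    obtain ⟨a, rfl⟩ := Submodule.mem_span_singleton.mp hz
    refine ⟨a, ?_⟩
    rwa [add_assoc, ZModModule.add_self, add_zero]
  · rintro ⟨a, ha⟩
    refine ⟨_, ha, a • w, Submodule.smul_mem _ _ (Submodule.mem_span_singleton_self w), ?_⟩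
    rw [add_assoc, ZModModule.add_self, add_zero]

/-- Since `w ∉ D`, an array with rows in `D + ⟨w⟩` is moved into `D` by exactly one `u`, and no
other array is. -/
theorem sum_psi_add_smul {D : Submodule (ZMod 2) (Fin N → ZMod 2)} {w : Fin N → ZMod 2}
    (hw : w ∉ D) (A : Fin N → Fin m → ZMod 2) :
    ∑ u : Fin m → ZMod 2, psi m D (A + fun i => w i • u) =
      psi m (D ⊔ Submodule.span (ZMod 2) {w}) A := by
  have hrow : ∀ (u : Fin m → ZMod 2) j,
      (fun i => (A + fun i => w i • u : Fin N → Fin m → ZMod 2) i j) =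
        (fun i => A i j) + u j • w := by
    intro u j
    funext i
    simp [mul_comm]
  by_cases hA : ∀ j, (fun i => A i j) ∈ D ⊔ Submodule.span (ZMod 2) {w}
  · rw [psi_of_mem hA]
    choose u hu using fun j => mem_sup_span_singleton_iff.mp (hA j)
    rw [Finset.sum_eq_single u]
    · refine psi_of_mem fun j => ?_
      rw [hrow]
      exact hu j
    · intro u' _ hne
      by_contra h0
      obtain ⟨j, hj⟩ := Function.ne_iff.mp hne
      have h1 := psi_ne_zero_iff.mp h0 j
      rw [hrow] at h1
      have h2 := D.sub_mem h1 (hu j)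
      rw [add_sub_add_left_eq_sub, ← sub_smul] at h2
      rcases zmod_two_cases (u' j - u j) with h | h
      · exact hj (sub_eq_zero.mp h)
      · rw [h, one_smul] at h2
        exact hw h2
    · simp
  · rw [psi, if_neg hA]
    refine Finset.sum_eq_zero fun u _ => ?_
    by_contra h0
    refine hA fun j => mem_sup_span_singleton_iff.mpr ⟨u j, ?_⟩
    rw [← hrow]
    exact psi_ne_zero_iff.mp h0 j

end Reverse

/-! ### The averaging operator -/

section Averaging

variable {m N : ℕ}

/-- The average of the gates attached to the nontrivial shifts, followed by the projection onto
admissible monomials. -/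
def gateAverage (m : ℕ) :
    MvPolynomial (Fin m → ZMod 2) ℂ →ₗ[ℂ] MvPolynomial (Fin m → ZMod 2) ℂ :=
  (2 ^ m - 1 : ℂ)⁻¹ • ∑ u ∈ Finset.univ.erase (0 : Fin m → ZMod 2),
    admissibleProj m ∘ₗ (polyAct (gateU (shiftU u) (shiftU_mul_self u)).1).toLinearMap

theorem two_pow_sub_one_pos (hm : 1 ≤ m) : (0 : ℝ) < 2 ^ m - 1 := by
  have := one_lt_pow₀ (one_lt_two : (1 : ℝ) < 2) (Nat.one_le_iff_ne_zero.mp hm)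
  linarith

theorem two_pow_sub_one_ne_zero (hm : 1 ≤ m) : (2 ^ m - 1 : ℂ) ≠ 0 := by
  exact_mod_cast (two_pow_sub_one_pos hm).ne'

theorem card_erase_zero :
    ((Finset.univ.erase (0 : Fin m → ZMod 2)).card : ℂ) = 2 ^ m - 1 := by
  rw [Finset.card_erase_of_mem (Finset.mem_univ _), Finset.card_univ, Fintype.card_fun, ZMod.card,
    Fintype.card_fin, Nat.cast_sub Nat.one_le_two_pow]
  push_cast
  rfl

theorem gateAverage_eq_self (hm : 1 ≤ m) {p : MvPolynomial (Fin m → ZMod 2) ℂ}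
    (hp : p ∈ homogeneousInvariants (complexCliffordGroup m) N) : gateAverage m p = p := by
  rw [gateAverage, LinearMap.smul_apply, LinearMap.sum_apply,
    Finset.sum_congr rfl (g := fun _ => p), Finset.sum_const, ← Nat.cast_smul_eq_nsmul ℂ,
    card_erase_zero, smul_smul, inv_mul_cancel₀ (two_pow_sub_one_ne_zero hm), one_smul]
  intro u _
  rw [LinearMap.comp_apply, AlgHom.toLinearMap_apply, hp.2 _ (gateU_shiftU_mem u)]
  exact admissibleProj_eq_self fun s hs => (eight_dvd_and_isAdmissible_of_coeff_ne_zero hp hs).2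

open Classical in
/-- The words that extend `D` to a larger doubly-even code. -/
def properExtensionWords (D : Submodule (ZMod 2) (Fin N → ZMod 2)) : Finset (Fin N → ZMod 2) :=
  (extensionWords D).filter fun w => w ∉ D

theorem mem_properExtensionWords {D : Submodule (ZMod 2) (Fin N → ZMod 2)}
    {w : Fin N → ZMod 2} : w ∈ properExtensionWords D ↔ w ∈ extensionWords D ∧ w ∉ D := by
  simp [properExtensionWords]

/-- The diagonal coefficients of the averaging operator. -/
def gateCoeff (m : ℕ) (D : Submodule (ZMod 2) (Fin N → ZMod 2)) : ℝ :=
  (Real.sqrt 2)⁻¹ ^ N * (Nat.card D - (2 ^ m - 1)⁻¹ * (properExtensionWords D).card)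

/-- Words in `D` leave `psi m D` unchanged. For the others the sum over all `u` is the indicator for
the enlarged code, and the omitted `u = 0` accounts for the subtracted `psi m D A`. -/
theorem sum_psi_extensionWords {D : Submodule (ZMod 2) (Fin N → ZMod 2)} (hD : IsDoublyEven D)
    (A : Fin N → Fin m → ZMod 2) :
    ∑ u ∈ Finset.univ.erase (0 : Fin m → ZMod 2),
        ∑ w ∈ extensionWords D, psi m D (A + fun i => w i • u) =
      (2 ^ m - 1) * Nat.card D * psi m D A + ∑ w ∈ properExtensionWords D,
        (psi m (D ⊔ Submodule.span (ZMod 2) {w}) A - psi m D A) := by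
  classical
  rw [Finset.sum_comm, ← Finset.sum_filter_add_sum_filter_not (extensionWords D) (· ∈ D)]
  congr 1
  · have hfilter : (extensionWords D).filter (· ∈ D) = Finset.univ.filter (· ∈ D) := by
      ext w
      simp only [Finset.mem_filter, Finset.mem_univ, true_and, and_iff_right_iff_imp]
      exact mem_extensionWords_of_mem hD
    have hcard : (Finset.univ.filter (· ∈ D)).card = Nat.card D := by
      rw [← Fintype.card_subtype, Nat.card_eq_fintype_card]
    rw [hfilter, Finset.sum_congr rfl (g := fun _ => (2 ^ m - 1) * psi m D A), Finset.sum_const,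
      nsmul_eq_mul, hcard]
    · ring
    · intro w hw
      rw [Finset.sum_congr rfl fun u _ => psi_add_smul (Finset.mem_filter.mp hw).2 u A,
        Finset.sum_const, nsmul_eq_mul, card_erase_zero]
  · rw [properExtensionWords]
    refine Finset.sum_congr (Finset.filter_congr_decidable _ _ _).symm fun w hw => ?_
    rw [← sum_psi_add_smul (Finset.mem_filter.mp hw).2 A,
      ← Finset.add_sum_erase _ _ (Finset.mem_univ (0 : Fin m → ZMod 2))]
    have : (A + fun i => w i • (0 : Fin m → ZMod 2)) = A := by
      funext i
      simp
    rw [this, add_sub_cancel_left]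

theorem gateAverage_toPoly_psi (hm : 1 ≤ m) {D : Submodule (ZMod 2) (Fin N → ZMod 2)}
    (hD : IsDoublyEven D) :
    gateAverage m (toPoly (psi m D)) = (gateCoeff m D : ℂ) • toPoly (psi m D) +
      ((2 ^ m - 1 : ℂ)⁻¹ * (Real.sqrt 2 : ℂ)⁻¹ ^ N) • ∑ w ∈ properExtensionWords D,
        toPoly (psi m (D ⊔ Submodule.span (ZMod 2) {w})) := by
  classical
  have h1 : gateAverage m (toPoly (psi m D)) = toPoly ((2 ^ m - 1 : ℂ)⁻¹ •
      ∑ u ∈ Finset.univ.erase (0 : Fin m → ZMod 2), fun A => (Real.sqrt 2 : ℂ)⁻¹ ^ N *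
        ∑ w ∈ extensionWords D, psi m D (A + fun i => w i • u)) := by
    rw [gateAverage, LinearMap.smul_apply, LinearMap.sum_apply, map_smul, map_sum]
    congr 1
    refine Finset.sum_congr rfl fun u hu => ?_
    rw [LinearMap.comp_apply, AlgHom.toLinearMap_apply, polyAct_toPoly, admissibleProj_toPoly]
    congr 1
    funext A
    rw [← admissible_tact_gateU_psi hD (Finset.ne_of_mem_erase hu) A]
  rw [h1, ← map_sum, ← map_smul, ← map_smul, ← map_add]
  congr 1
  funext A
  simp only [Pi.smul_apply, Pi.add_apply, Finset.sum_apply, smul_eq_mul, ← Finset.mul_sum,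
    sum_psi_extensionWords hD A, gateCoeff, Finset.sum_sub_distrib, Finset.sum_const,
    nsmul_eq_mul]
  push_cast
  have h2 := two_pow_sub_one_ne_zero hm
  field_simp
  ring

/-- A doubly-even code that is not self-dual lies strictly inside its dual, so `|D|² < |D| |D^⊥| =
2^N`; the subtracted term only lowers the coefficient. -/
theorem gateCoeff_lt_one (hm : 1 ≤ m) {D : Submodule (ZMod 2) (Fin N → ZMod 2)}
    (hD : IsDoublyEven D) (hsd : ¬ IsSelfDual D) : gateCoeff m D < 1 := by
  classical
  set E := Finset.univ.filter fun w : Fin N → ZMod 2 => ∀ c ∈ D, w ⬝ᵥ c = 0 with hE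
  have hsub : Finset.univ.filter (· ∈ D) ⊂ E := by
    refine (Finset.ssubset_iff_of_subset fun w hw => ?_).mpr ?_
    · exact Finset.mem_filter.mpr ⟨Finset.mem_univ _, fun c hc =>
        hD.dotProduct_eq_zero (Finset.mem_filter.mp hw).2 hc⟩
    · by_contra! hcon
      refine hsd fun v => ⟨fun hv c hc => hD.dotProduct_eq_zero hv hc, fun hv => ?_⟩
      exact (Finset.mem_filter.mp (hcon v (Finset.mem_filter.mpr ⟨Finset.mem_univ _, hv⟩))).2
  have hcard : (Finset.univ.filter (· ∈ D)).card = Nat.card D := by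
    rw [← Fintype.card_subtype, Nat.card_eq_fintype_card]
  have hlt : Nat.card D < E.card := hcard ▸ Finset.card_lt_card hsub
  have hsq : (Nat.card D : ℝ) ^ 2 < 2 ^ N := by
    have h1 : Nat.card D * Nat.card D < 2 ^ N := by
      rw [← card_mul_card_dual D]
      exact Nat.mul_lt_mul_of_pos_left hlt Nat.card_pos
    rw [sq]
    exact_mod_cast h1
  have hs : 0 < Real.sqrt 2 ^ N := by positivity
  have hlt2 : (Nat.card D : ℝ) < Real.sqrt 2 ^ N := by
    refine lt_of_pow_lt_pow_left₀ 2 hs.le ?_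
    rwa [← pow_mul, mul_comm, pow_mul, Real.sq_sqrt (by norm_num)]
  have hK := two_pow_sub_one_pos hm
  rw [gateCoeff, inv_pow, inv_mul_lt_iff₀ hs, mul_one]
  have : 0 ≤ (2 ^ m - 1 : ℝ)⁻¹ * (properExtensionWords D).card := by positivity
  linarith

theorem isDoublyEven_sup_span {D : Submodule (ZMod 2) (Fin N → ZMod 2)} (hD : IsDoublyEven D)
    {w : Fin N → ZMod 2} (hw : w ∈ extensionWords D) :
    IsDoublyEven (D ⊔ Submodule.span (ZMod 2) {w}) := by
  intro x hx
  obtain ⟨a, ha⟩ := mem_sup_span_singleton_iff.mp hx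
  obtain ⟨hwD, hw4⟩ := mem_extensionWords.mp hw
  rcases zmod_two_cases a with rfl | rfl
  · rw [zero_smul, add_zero] at ha
    exact hD x ha
  · rw [one_smul] at ha
    have h : x = w + (x + w) := by rw [add_left_comm, ZModModule.add_self, add_zero]
    rw [h, ← I_pow_eq_one_iff, I_pow_hammingNorm_add, I_pow_eq_one_iff.mpr hw4,
      I_pow_of_mem hD ha, hwD _ ha]
    simp

theorem mem_span_selfDual_of_invariant (hm : 1 ≤ m) {p : MvPolynomial (Fin m → ZMod 2) ℂ}
    (hp : p ∈ homogeneousInvariants (complexCliffordGroup m) N) :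
    p ∈ Submodule.span ℂ ((fun D : EvenCode N => toPoly (psi m D.1)) ''
      {D : EvenCode N | IsSelfDual D.1}) := by
  refine mem_span_of_triangular _ (gateAverage m) (fun D => (gateCoeff m D.1 : ℂ)) ?_ ?_ ?_
    (mem_span_psi_of_invariant hp) (gateAverage_eq_self hm hp)
  -- A doubly-even code that contains a self-dual code is itself self-dual, so the self-dual codes
  -- form an upper set.
  · intro D D' hle hsd v
    refine ⟨fun hv c hc => D'.2.1.dotProduct_eq_zero hv hc, fun hv => hle ?_⟩
    exact (hsd v).mpr fun c hc => hv c (hle hc)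
  · intro D
    rw [gateAverage_toPoly_psi hm D.2.1, add_sub_cancel_left]
    refine Submodule.smul_mem _ _ (sum_mem fun w hw => Submodule.subset_span ?_)
    obtain ⟨hwE, hwD⟩ := mem_properExtensionWords.mp hw
    refine ⟨⟨D.1 ⊔ Submodule.span (ZMod 2) {w}, isDoublyEven_sup_span D.2.1 hwE,
      (le_sup_left : D.1 ≤ _) D.2.2⟩, ?_, rfl⟩
    refine lt_of_le_of_ne (le_sup_left : D.1 ≤ _) fun h => hwD ?_
    exact h.ge ((le_sup_right : _ ≤ D.1 ⊔ _) (Submodule.mem_span_singleton_self w))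
  · intro D hsd h1
    exact (gateCoeff_lt_one hm D.2.1 hsd).ne (by exact_mod_cast h1)

end Averaging

end

end Clifford

theorem mainTheorem3 (m N : ℕ) (hm : 1 ≤ m) (F : Type*) [Field F] [Fintype F]
    [Algebra (ZMod 2) F] (b : Module.Basis (Fin m) (ZMod 2) F) :
    Submodule.span ℂ
        {p : MvPolynomial (Fin m → ZMod 2) ℂ |
          ∃ C : Submodule (ZMod 2) (Fin N → ZMod 2),
            Clifford.IsSelfDual C ∧ Clifford.IsDoublyEven C ∧
              p = MvPolynomial.rename b.equivFun (Clifford.cwe (Clifford.extendScalars F C))} =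
      Clifford.homogeneousInvariants (Clifford.complexCliffordGroup m) N ∧
    (¬ 8 ∣ N →
      Clifford.homogeneousInvariants (Clifford.complexCliffordGroup m) N = ⊥) := by
  refine ⟨le_antisymm (Submodule.span_le.mpr ?_) fun p hp => ?_, fun hN => ?_⟩
  · rintro _ ⟨C, hC, hD, rfl⟩
    rw [Clifford.rename_cwe_extendScalars b C]
    exact Clifford.toPoly_psi_mem_homogeneousInvariants hC hD
  · refine Submodule.span_mono ?_ (Clifford.mem_span_selfDual_of_invariant hm hp)
    rintro _ ⟨D, hD, rfl⟩
    exact ⟨D.1, hD, D.2.1, (Clifford.rename_cwe_extendScalars b D.1).symm⟩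
  · refine (Submodule.eq_bot_iff _).mpr fun p hp => ?_
    ext s
    by_contra hs
    exact hN (Clifford.eight_dvd_and_isAdmissible_of_coeff_ne_zero hp hs).1
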